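/- Let $C$ be a coassociative counital coalgebra over a field $k$, with comultiplication $\mu$ and counit $\varepsilon$. A left (right) $C$-comodule is a $k$-vector space with a coassociative and counital coaction $\nu_M\colon M\to C\otimes_k M$ (respectively $\nu_N\colon N\to N\otimes_k C$). A left $C$-contramodule is a $k$-vector space $P$ with a linear map $\pi_P\colon \mathrm{Hom}_k(C,P)\to P$ such that $\pi_P(c\mapsto\varepsilon(c)p)=p$ for all $p\in P$, and $\pi_P(\pi_P\circ F)=\pi_P(\widetilde F\circ\mu)$ for all linear $F\colon C\to\mathrm{Hom}_k(C,P)$, where $\widetilde F(u\otimes v)=F(v)(u)$. With the evident morphisms, each of these three kinds of objects forms an abelian category, in which exactness is exactness of the underlying sequence of vector spaces. For a right comodule $N$, a left comodule $M$ and a left contramodule $P$, let - $N\mathbin{\square_C}M$ be the kernel of $\nu_N\otimes\mathrm{id}-\mathrm{id}\otimes\nu_M\colon N\otimes_k M\to N\otimes_k C\otimes_k M$; - $\mathrm{Cohom}_C(M,P)$ be the cokernel of the map $\mathrm{Hom}_k(C\otimes_k M,P)\to\mathrm{Hom}_k(M,P)$, $g\mapsto g\circ\nu_M-\bigl(m\mapsto\pi_P(c\mapsto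 g(c\otimes m))\bigr)$; - $N\odot_C P$ be the cokernel of $(\mathrm{id}\otimes\mathrm{ev}_C)\circ(\nu_N\otimes\mathrm{id})-\mathrm{id}\otimes\pi_P\colon N\otimes_k\mathrm{Hom}_k(C,P)\to N\otimes_k P$, where $\mathrm{ev}_C\colon C\otimes_k\mathrm{Hom}_k(C,P)\to P$ is the evaluation map. A left comodule $M$ is called coflat if the functor $-\mathbin{\square_C}M$ is exact on right comodules, and coprojective if the functor $\mathrm{Cohom}_C(M,-)$ is exact on left contramodules. A left contramodule $P$ is called contraflat if the functor $-\odot_C P$ is exact on right comodules, and coinjective if the contravariant functor $\mathrm{Cohom}_C(-,P)$ is exact on left comodules. Then: (a) a left $C$-comodule is coflat if and only if it is coprojective, and if and only if it is an injective object of the category of left $C$-comodules; (b) a left $C$-contramodule is contraflat if and only if it is coinjective, and if and only if it is a projective object of the category of left $C$-contramodules. -/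

import Mathlib

open CategoryTheory
open scoped TensorProduct

universe u

namespace Contra

/-- `0 → A → B → D → 0` is a short exact sequence of vector spaces. -/
structure ShortExactSeq {k : Type u} [Field k] {A B D : Type u}
    [AddCommGroup A] [Module k A] [AddCommGroup B] [Module k B] [AddCommGroup D] [Module k D]
    (f : A →ₗ[k] B) (g : B →ₗ[k] D) : Prop where
  injective : Function.Injective f
  exact : Function.Exact f g
  surjective : Function.Surjective g

/-- Left comodules over the coalgebra `C`. -/
structure LeftComodule (k C : Type u) [Field k] [AddCommGroup C] [Module k C]
    [Coalgebra k C] where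
  carrier : Type u
  [addCommGroup : AddCommGroup carrier]
  [module : Module k carrier]
  /-- the coaction `ν : M → C ⊗ M` -/
  coact : carrier →ₗ[k] C ⊗[k] carrier
  coassoc : (TensorProduct.assoc k C C carrier).toLinearMap ∘ₗ
      (Coalgebra.comul (R := k) (A := C)).rTensor carrier ∘ₗ coact = coact.lTensor C ∘ₗ coact
  counit_coact : (Coalgebra.counit (R := k) (A := C)).rTensor carrier ∘ₗ coact =
      TensorProduct.mk k k carrier 1

/-- Right comodules over the coalgebra `C`. -/
structure RightComodule (k C : Type u) [Field k] [AddCommGroup C] [Module k C]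
    [Coalgebra k C] where
  carrier : Type u
  [addCommGroup : AddCommGroup carrier]
  [module : Module k carrier]
  /-- the coaction `ν : N → N ⊗ C` -/
  coact : carrier →ₗ[k] carrier ⊗[k] C
  coassoc : (TensorProduct.assoc k carrier C C).toLinearMap ∘ₗ coact.rTensor C ∘ₗ coact =
      (Coalgebra.comul (R := k) (A := C)).lTensor carrier ∘ₗ coact
  counit_coact : (Coalgebra.counit (R := k) (A := C)).lTensor carrier ∘ₗ coact =
      (TensorProduct.mk k carrier k).flip 1

/-- Left contramodules over the coalgebra `C`. A map `F : C → Hom(C, P)` is identified with the map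
`C ⊗ C → P`, `u ⊗ v ↦ F v u` (the "left" rule `Hom(U ⊗ V, W) ≃ Hom(V, Hom(U, W))`). -/
structure LeftContramodule (k C : Type u) [Field k] [AddCommGroup C] [Module k C]
    [Coalgebra k C] where
  carrier : Type u
  [addCommGroup : AddCommGroup carrier]
  [module : Module k carrier]
  /-- the contraaction `π : Hom(C, P) → P` -/
  contract : (C →ₗ[k] carrier) →ₗ[k] carrier
  contraassoc : ∀ F : C →ₗ[k] C →ₗ[k] carrier,
    contract (TensorProduct.lift F.flip ∘ₗ Coalgebra.comul) = contract (contract ∘ₗ F)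
  contraunit : ∀ p : carrier,
    contract ((Coalgebra.counit (R := k) (A := C)).smulRight p) = p

attribute [instance] LeftComodule.addCommGroup LeftComodule.module
attribute [instance] RightComodule.addCommGroup RightComodule.module
attribute [instance] LeftContramodule.addCommGroup LeftContramodule.module

section

variable {k C : Type u} [Field k] [AddCommGroup C] [Module k C] [Coalgebra k C]

/-- Morphisms of left comodules. -/
@[ext]
structure LeftComodule.Hom (L M : LeftComodule k C) where
  toLin : L.carrier →ₗ[k] M.carrier
  comm : M.coact ∘ₗ toLin = toLin.lTensor C ∘ₗ L.coact

/-- Morphisms of right comodules. -/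
@[ext]
structure RightComodule.Hom (L N : RightComodule k C) where
  toLin : L.carrier →ₗ[k] N.carrier
  comm : N.coact ∘ₗ toLin = toLin.rTensor C ∘ₗ L.coact

/-- Morphisms of left contramodules. -/
@[ext]
structure LeftContramodule.Hom (P Q : LeftContramodule k C) where
  toLin : P.carrier →ₗ[k] Q.carrier
  comm : ∀ f : C →ₗ[k] P.carrier, toLin (P.contract f) = Q.contract (toLin ∘ₗ f)

/-- The category of left `C`-comodules. -/
instance : Category (LeftComodule k C) where
  Hom L M := LeftComodule.Hom L M
  id L := ⟨LinearMap.id, by simp⟩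
  comp f g := ⟨g.toLin ∘ₗ f.toLin, by
    rw [← LinearMap.comp_assoc, g.comm, LinearMap.comp_assoc, f.comm, LinearMap.lTensor_comp,
      LinearMap.comp_assoc]⟩

/-- The category of right `C`-comodules. -/
instance : Category (RightComodule k C) where
  Hom L M := RightComodule.Hom L M
  id L := ⟨LinearMap.id, by simp⟩
  comp f g := ⟨g.toLin ∘ₗ f.toLin, by
    rw [← LinearMap.comp_assoc, g.comm, LinearMap.comp_assoc, f.comm, LinearMap.rTensor_comp,
      LinearMap.comp_assoc]⟩

/-- The category of left `C`-contramodules. -/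
instance : Category (LeftContramodule k C) where
  Hom L M := LeftContramodule.Hom L M
  id L := ⟨LinearMap.id, by simp⟩
  comp f g := ⟨g.toLin ∘ₗ f.toLin, fun h => by
    simp only [LinearMap.comp_apply, f.comm, g.comm, LinearMap.comp_assoc]⟩

/-! ### Cotensor product -/

/-- The difference of the two maps `N ⊗ M ⇉ N ⊗ C ⊗ M` induced by the coactions. -/
noncomputable def cotensorDiff (N : RightComodule k C) (M : LeftComodule k C) :
    N.carrier ⊗[k] M.carrier →ₗ[k] N.carrier ⊗[k] (C ⊗[k] M.carrier) :=
  (TensorProduct.assoc k N.carrier C M.carrier).toLinearMap ∘ₗ N.coact.rTensor M.carrier -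
    M.coact.lTensor N.carrier

/-- The cotensor product `N □_C M`, a subspace of `N ⊗ M`. -/
noncomputable def cotensor (N : RightComodule k C) (M : LeftComodule k C) :
    Submodule k (N.carrier ⊗[k] M.carrier) :=
  LinearMap.ker (cotensorDiff N M)

theorem cotensorDiff_naturality {N N' : RightComodule k C} (f : N ⟶ N') (M : LeftComodule k C) :
    cotensorDiff N' M ∘ₗ f.toLin.rTensor M.carrier =
      f.toLin.rTensor (C ⊗[k] M.carrier) ∘ₗ cotensorDiff N M := by
  have h : N'.coact.rTensor M.carrier ∘ₗ f.toLin.rTensor M.carrier =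
      (f.toLin.rTensor C).rTensor M.carrier ∘ₗ N.coact.rTensor M.carrier := by
    rw [← LinearMap.rTensor_comp, f.comm, LinearMap.rTensor_comp]
  have h2 : (TensorProduct.assoc k N'.carrier C M.carrier).toLinearMap ∘ₗ
      (f.toLin.rTensor C).rTensor M.carrier =
      f.toLin.rTensor (C ⊗[k] M.carrier) ∘ₗ
        (TensorProduct.assoc k N.carrier C M.carrier).toLinearMap := by
    ext; simp
  rw [cotensorDiff, cotensorDiff, LinearMap.sub_comp, LinearMap.comp_sub, LinearMap.comp_assoc, h,
    ← LinearMap.comp_assoc, h2, LinearMap.comp_assoc]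
  congr 1
  ext; simp

/-- The functor `- □_C M` on morphisms. -/
noncomputable def cotensorMap {N N' : RightComodule k C} (f : N ⟶ N') (M : LeftComodule k C) :
    cotensor N M →ₗ[k] cotensor N' M :=
  (f.toLin.rTensor M.carrier).restrict fun x hx => by
    have h := LinearMap.congr_fun (cotensorDiff_naturality f M) x
    simp only [LinearMap.comp_apply] at h
    rw [cotensor, LinearMap.mem_ker] at hx ⊢
    rw [h, hx, map_zero]

/-! ### Cohomomorphisms -/

/-- The difference of the two maps `Hom(C ⊗ M, P) ⇉ Hom(M, P)`: one sends `g` to `g ∘ ν`, the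
other one sends `g` to `m ↦ π (c ↦ g (c ⊗ m))`. -/
noncomputable def cohomDiff (M : LeftComodule k C) (P : LeftContramodule k C) :
    (C ⊗[k] M.carrier →ₗ[k] P.carrier) →ₗ[k] (M.carrier →ₗ[k] P.carrier) where
  toFun g := g ∘ₗ M.coact - P.contract ∘ₗ (TensorProduct.curry g).flip
  map_add' g h := by
    have e : (TensorProduct.curry (g + h)).flip =
        (TensorProduct.curry g).flip + (TensorProduct.curry h).flip := rfl
    rw [e, LinearMap.add_comp, LinearMap.comp_add, add_sub_add_comm]
  map_smul' a g := by
    have e : (TensorProduct.curry (a • g)).flip = a • (TensorProduct.curry g).flip := rfl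
    rw [e, LinearMap.smul_comp, LinearMap.comp_smul, RingHom.id_apply, smul_sub]

/-- The space of cohomomorphisms `Cohom_C(M, P)`, a quotient space of `Hom(M, P)`. -/
abbrev Cohom (M : LeftComodule k C) (P : LeftContramodule k C) : Type u :=
  (M.carrier →ₗ[k] P.carrier) ⧸ LinearMap.range (cohomDiff M P)

/-- The functor `Cohom_C(-, P)` on morphisms. -/
noncomputable def cohomMapLeft {L M : LeftComodule k C} (f : L ⟶ M) (P : LeftContramodule k C) :
    Cohom M P →ₗ[k] Cohom L P :=
  Submodule.mapQ _ _ (LinearMap.lcomp k P.carrier f.toLin) <| by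
    rintro _ ⟨g, rfl⟩
    refine ⟨g ∘ₗ f.toLin.lTensor C, ?_⟩
    ext m
    have h := LinearMap.congr_fun f.comm m
    simp only [LinearMap.comp_apply] at h
    simp only [cohomDiff, LinearMap.coe_mk, AddHom.coe_mk, LinearMap.sub_apply,
      LinearMap.comp_apply, LinearMap.lcomp_apply, h]
    rfl

/-- The functor `Cohom_C(M, -)` on morphisms. -/
noncomputable def cohomMapRight (M : LeftComodule k C) {P Q : LeftContramodule k C} (f : P ⟶ Q) :
    Cohom M P →ₗ[k] Cohom M Q :=
  Submodule.mapQ _ _ (f.toLin.compRight k) <| by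
    rintro _ ⟨g, rfl⟩
    refine ⟨f.toLin ∘ₗ g, ?_⟩
    ext m
    simp only [cohomDiff, LinearMap.coe_mk, AddHom.coe_mk, LinearMap.sub_apply,
      LinearMap.comp_apply, LinearMap.compRight_apply, map_sub, f.comm]
    rfl

/-! ### Contratensor product -/

/-- The difference of the two maps `N ⊗ Hom(C, P) ⇉ N ⊗ P`: one is the composition
`N ⊗ Hom(C, P) → N ⊗ C ⊗ Hom(C, P) → N ⊗ P` of coaction and evaluation, the other one is induced
by the contraaction. -/
noncomputable def contratensorDiff (N : RightComodule k C) (P : LeftContramodule k C) :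
    N.carrier ⊗[k] (C →ₗ[k] P.carrier) →ₗ[k] N.carrier ⊗[k] P.carrier :=
  (TensorProduct.lift (LinearMap.applyₗ (R := k) (M := C) (M₂ := P.carrier))).lTensor N.carrier ∘ₗ
      (TensorProduct.assoc k N.carrier C (C →ₗ[k] P.carrier)).toLinearMap ∘ₗ
      N.coact.rTensor (C →ₗ[k] P.carrier) -
    P.contract.lTensor N.carrier

/-- The contratensor product `N ⊙_C P`, a quotient space of `N ⊗ P`. -/
abbrev Contratensor (N : RightComodule k C) (P : LeftContramodule k C) : Type u :=
  (N.carrier ⊗[k] P.carrier) ⧸ LinearMap.range (contratensorDiff N P)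

theorem contratensorDiff_naturality {N N' : RightComodule k C} (f : N ⟶ N')
    (P : LeftContramodule k C) :
    contratensorDiff N' P ∘ₗ f.toLin.rTensor (C →ₗ[k] P.carrier) =
      f.toLin.rTensor P.carrier ∘ₗ contratensorDiff N P := by
  have h : N'.coact.rTensor (C →ₗ[k] P.carrier) ∘ₗ f.toLin.rTensor (C →ₗ[k] P.carrier) =
      (f.toLin.rTensor C).rTensor (C →ₗ[k] P.carrier) ∘ₗ
        N.coact.rTensor (C →ₗ[k] P.carrier) := by
    rw [← LinearMap.rTensor_comp, f.comm, LinearMap.rTensor_comp]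
  have h2 : (TensorProduct.lift
      (LinearMap.applyₗ (R := k) (M := C) (M₂ := P.carrier))).lTensor N'.carrier ∘ₗ
      (TensorProduct.assoc k N'.carrier C (C →ₗ[k] P.carrier)).toLinearMap ∘ₗ
      (f.toLin.rTensor C).rTensor (C →ₗ[k] P.carrier) =
      f.toLin.rTensor P.carrier ∘ₗ (TensorProduct.lift
      (LinearMap.applyₗ (R := k) (M := C) (M₂ := P.carrier))).lTensor N.carrier ∘ₗ
        (TensorProduct.assoc k N.carrier C (C →ₗ[k] P.carrier)).toLinearMap := by
    apply TensorProduct.ext_threefold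
    intros; simp
  rw [contratensorDiff, contratensorDiff, LinearMap.sub_comp, LinearMap.comp_sub]
  congr 1
  · rw [LinearMap.comp_assoc, LinearMap.comp_assoc, h, ← LinearMap.comp_assoc,
      ← LinearMap.comp_assoc]
    rw [← LinearMap.comp_assoc] at h2
    rw [← LinearMap.comp_assoc] at h2
    rw [LinearMap.comp_assoc, ← LinearMap.comp_assoc, h2]
    simp only [LinearMap.comp_assoc]
  · apply TensorProduct.ext'
    intros; simp

/-- The functor `- ⊙_C P` on morphisms. -/
noncomputable def contratensorMap {N N' : RightComodule k C} (f : N ⟶ N')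
    (P : LeftContramodule k C) : Contratensor N P →ₗ[k] Contratensor N' P :=
  Submodule.mapQ _ _ (f.toLin.rTensor P.carrier) <| by
    rintro _ ⟨g, rfl⟩
    exact ⟨f.toLin.rTensor _ g, LinearMap.congr_fun (contratensorDiff_naturality f P) g⟩

/-! ### Adjusted objects

In the abelian categories of comodules and contramodules over a coalgebra over a field, kernels and
cokernels are formed on the underlying vector spaces, so a sequence of morphisms is short exact if
and only if it is so as a sequence of vector spaces. -/

/-- `M` is coflat: the functor `- □_C M` is exact on right comodules. -/
def Coflat (M : LeftComodule k C) : Prop :=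
  ∀ ⦃N₁ N₂ N₃ : RightComodule k C⦄ (f : N₁ ⟶ N₂) (g : N₂ ⟶ N₃),
    ShortExactSeq f.toLin g.toLin → ShortExactSeq (cotensorMap f M) (cotensorMap g M)

/-- `M` is coprojective: the functor `Cohom_C(M, -)` is exact on left contramodules. -/
def Coprojective (M : LeftComodule k C) : Prop :=
  ∀ ⦃P₁ P₂ P₃ : LeftContramodule k C⦄ (f : P₁ ⟶ P₂) (g : P₂ ⟶ P₃),
    ShortExactSeq f.toLin g.toLin → ShortExactSeq (cohomMapRight M f) (cohomMapRight M g)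

/-- `P` is contraflat: the functor `- ⊙_C P` is exact on right comodules. -/
def Contraflat (P : LeftContramodule k C) : Prop :=
  ∀ ⦃N₁ N₂ N₃ : RightComodule k C⦄ (f : N₁ ⟶ N₂) (g : N₂ ⟶ N₃),
    ShortExactSeq f.toLin g.toLin → ShortExactSeq (contratensorMap f P) (contratensorMap g P)

/-- `P` is coinjective: the contravariant functor `Cohom_C(-, P)` is exact on left comodules. -/
def Coinjective (P : LeftContramodule k C) : Prop :=
  ∀ ⦃M₁ M₂ M₃ : LeftComodule k C⦄ (f : M₁ ⟶ M₂) (g : M₂ ⟶ M₃),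
    ShortExactSeq f.toLin g.toLin → ShortExactSeq (cohomMapLeft g P) (cohomMapLeft f P)

end

end Contra

/-! Each half is a cycle: injective ⇒ split ⇒ coprojective ⇒ coflat ⇒ injective for comodules, and
projective ⇒ split ⇒ coinjective ⇒ contraflat ⇒ projective for contramodules. Split means a direct
summand of the cofree comodule `C ⊗ M`, respectively of the free contramodule `Hom(C, P)`.

A splitting yields an operator on `Hom(M, P)`, natural in the other argument, whose kernel is
exactly the range of `cohomDiff`. Since `Cohom` is right exact anyway, this makes it exact
(`LeftComodule.IsSplit.coprojective`, `LeftContramodule.IsSplit.coinjective`).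

The middle steps are dualities. The identity `Cohom_C(M, N^*) = (N □ M)^*` gives coprojective ⇒
coflat. For finite-dimensional `N` one has `N ⊙ P = Cohom_C(N^*, P)`, and every comodule is a union
of finite-dimensional subcomodules; this gives coinjective ⇒ contraflat.

For coflat ⇒ injective: if `L` is finite-dimensional, `Hom_C(L, M) = L^* □ M`, so coflatness extends
colinear maps between finite-dimensional comodules. Local finiteness and Zorn's lemma do the rest,
as in Baer's criterion.

The hardest step is contraflat ⇒ projective. Applying `- ⊙ P` to the cobar sequence `0 → N → N ⊗ C →
N ⊗ C ⊗ C` gives `N ⊙ P = N □ (C ⊙ P)`. Hence the left comodule `C ⊙ P` is coflat, so injective and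
split, and `Hom_C(C, C ⊙ P)` is projective. The unit from `P` to it becomes bijective under every `N
⊙ -`. That it is an isomorphism follows from a Nakayama lemma (`LeftContramodule.mem_of_dense`,
`surjective_of_contratensor`), applied to the unit and then to a section of it. -/

namespace Contra

/-! ### Tensors and their contractions with functionals -/

section Slices

variable {k : Type u} [Field k] {C V W : Type u} [AddCommGroup C] [Module k C]
  [AddCommGroup V] [Module k V] [AddCommGroup W] [Module k W]

/-- Contraction of the left tensor factor with a functional. -/
noncomputable def sliceLeft (V : Type u) [AddCommGroup V] [Module k V] (γ : Module.Dual k C) :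
    C ⊗[k] V →ₗ[k] V :=
  (TensorProduct.lid k V).toLinearMap ∘ₗ γ.rTensor V

/-- Contraction of the right tensor factor with a functional. -/
noncomputable def sliceRight (V : Type u) [AddCommGroup V] [Module k V] (γ : Module.Dual k C) :
    V ⊗[k] C →ₗ[k] V :=
  (TensorProduct.rid k V).toLinearMap ∘ₗ γ.lTensor V

@[simp]
theorem sliceLeft_tmul (γ : Module.Dual k C) (c : C) (v : V) :
    sliceLeft V γ (c ⊗ₜ v) = γ c • v := by
  simp [sliceLeft]

@[simp]
theorem sliceRight_tmul (γ : Module.Dual k C) (c : C) (v : V) :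
    sliceRight V γ (v ⊗ₜ c) = γ c • v := by
  simp [sliceRight]

theorem sliceLeft_lTensor (γ : Module.Dual k C) (f : V →ₗ[k] W) (x : C ⊗[k] V) :
    sliceLeft W γ (f.lTensor C x) = f (sliceLeft V γ x) := by
  induction x <;> simp_all

theorem sliceRight_rTensor (γ : Module.Dual k C) (f : V →ₗ[k] W) (x : V ⊗[k] C) :
    sliceRight W γ (f.rTensor C x) = f (sliceRight V γ x) := by
  induction x <;> simp_all

/-- The coordinates of `x` with respect to a basis of `C` are its slices by the coordinate
functionals. -/
theorem eq_zero_of_sliceLeft {x : C ⊗[k] V} (h : ∀ γ, sliceLeft V γ x = 0) : x = 0 := by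
  classical
  apply (TensorProduct.equivFinsuppOfBasisLeft (N := V) (Module.Basis.ofVectorSpace k C)).injective
  ext i
  rw [TensorProduct.equivFinsuppOfBasisLeft_apply, map_zero]
  exact h _

theorem eq_zero_of_sliceRight {x : V ⊗[k] C} (h : ∀ γ, sliceRight V γ x = 0) : x = 0 := by
  apply (TensorProduct.comm k V C).injective
  rw [map_zero]
  refine eq_zero_of_sliceLeft fun γ => ?_
  rw [← h γ]
  clear h
  induction x <;> simp_all

theorem sliceLeft_ext {x y : C ⊗[k] V} (h : ∀ γ, sliceLeft V γ x = sliceLeft V γ y) : x = y :=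
  sub_eq_zero.1 <| eq_zero_of_sliceLeft fun γ => by rw [map_sub, h, sub_self]

theorem sliceRight_ext {x y : V ⊗[k] C} (h : ∀ γ, sliceRight V γ x = sliceRight V γ y) : x = y :=
  sub_eq_zero.1 <| eq_zero_of_sliceRight fun γ => by rw [map_sub, h, sub_self]

/-- Modulo `S` all slices vanish, so the image of `x` in `C ⊗ (V / S)` is zero. -/
theorem mem_range_lTensor_of_sliceLeft (S : Submodule k V) {x : C ⊗[k] V}
    (h : ∀ γ, sliceLeft V γ x ∈ S) : x ∈ LinearMap.range (S.subtype.lTensor C) := by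
  have he : Function.Exact (S.subtype.lTensor C) (S.mkQ.lTensor C) :=
    lTensor_exact C (LinearMap.exact_subtype_mkQ S) S.mkQ_surjective
  refine (he x).1 (eq_zero_of_sliceLeft fun γ => ?_)
  rw [sliceLeft_lTensor]
  simpa using h γ

theorem mem_range_rTensor_of_sliceRight (S : Submodule k V) {x : V ⊗[k] C}
    (h : ∀ γ, sliceRight V γ x ∈ S) : x ∈ LinearMap.range (S.subtype.rTensor C) := by
  have he : Function.Exact (S.subtype.rTensor C) (S.mkQ.rTensor C) :=
    rTensor_exact C (LinearMap.exact_subtype_mkQ S) S.mkQ_surjective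
  refine (he x).1 (eq_zero_of_sliceRight fun γ => ?_)
  rw [sliceRight_rTensor]
  simpa using h γ

theorem exists_finite_sliceLeft (x : C ⊗[k] V) :
    ∃ S : Submodule k V, Module.Finite k S ∧ ∀ γ, sliceLeft V γ x ∈ S := by
  obtain ⟨S, hS, h⟩ := TensorProduct.exists_finite_submodule_right_of_setFinite {x}
    (Set.finite_singleton x)
  refine ⟨S, hS, fun γ => ?_⟩
  obtain ⟨y, rfl⟩ := h rfl
  rw [sliceLeft_lTensor]
  exact Subtype.prop _

theorem exists_finite_sliceRight (x : V ⊗[k] C) :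
    ∃ S : Submodule k V, Module.Finite k S ∧ ∀ γ, sliceRight V γ x ∈ S := by
  obtain ⟨S, hS, h⟩ := TensorProduct.exists_finite_submodule_left_of_setFinite {x}
    (Set.finite_singleton x)
  refine ⟨S, hS, fun γ => ?_⟩
  obtain ⟨y, rfl⟩ := h rfl
  rw [sliceRight_rTensor]
  exact Subtype.prop _

theorem lTensor_injective (C : Type u) [AddCommGroup C] [Module k C] {f : V →ₗ[k] W}
    (hf : Function.Injective f) : Function.Injective (f.lTensor C) :=
  Module.Flat.lTensor_preserves_injective_linearMap f hf

theorem rTensor_injective (C : Type u) [AddCommGroup C] [Module k C] {f : V →ₗ[k] W}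
    (hf : Function.Injective f) : Function.Injective (f.rTensor C) :=
  Module.Flat.rTensor_preserves_injective_linearMap f hf

end Slices

variable {k C : Type u} [Field k] [AddCommGroup C] [Module k C] [Coalgebra k C]

/-! ### Left comodules as locally finite modules -/

namespace LeftComodule

/-- The action of the dual algebra on a left comodule. -/
noncomputable def act (M : LeftComodule k C) (γ : Module.Dual k C) :
    M.carrier →ₗ[k] M.carrier :=
  sliceLeft M.carrier γ ∘ₗ M.coact

theorem act_counit (M : LeftComodule k C) (m : M.carrier) :
    M.act Coalgebra.counit m = m := by
  have h := LinearMap.congr_fun M.counit_coact m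
  simp only [LinearMap.comp_apply] at h
  simp [act, sliceLeft, h]

/-- Coassociativity: the composite is the action of a convolution product, with the functional
acting first on the left factor of the comultiplication. What is used later is that composites of
actions are again actions, so orbits are stable. -/
theorem act_act (M : LeftComodule k C) (γ γ' : Module.Dual k C) (m : M.carrier) :
    M.act γ' (M.act γ m) =
      M.act (LinearMap.mul' k k ∘ₗ TensorProduct.map γ γ' ∘ₗ Coalgebra.comul) m := by
  have h := LinearMap.congr_fun M.coassoc m
  simp only [LinearMap.comp_apply, LinearEquiv.coe_coe] at h
  simp only [act, LinearMap.comp_apply]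
  rw [← sliceLeft_lTensor, ← h]
  generalize M.coact m = x
  induction x with
  | zero => simp
  | add x y hx hy => simp only [map_add, hx, hy]
  | tmul c m =>
    simp only [LinearMap.rTensor_tmul, sliceLeft_tmul, LinearMap.comp_apply]
    generalize Coalgebra.comul (R := k) c = y
    induction y with
    | zero => simp
    | add x y hx hy => simp only [map_add, TensorProduct.add_tmul, hx, hy, add_smul]
    | tmul a b => simp [mul_smul]

/-- The subcomodule on a subspace that is stable under the dual algebra. -/
noncomputable def sub (M : LeftComodule k C) (S : Submodule k M.carrier)
    (hS : ∀ γ, ∀ m ∈ S, M.act γ m ∈ S) : LeftComodule k C :=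
  let e := LinearEquiv.ofInjective (S.subtype.lTensor C) (lTensor_injective C S.subtype_injective)
  have hr : ∀ s : S, M.coact s ∈ LinearMap.range (S.subtype.lTensor C) := fun s =>
    mem_range_lTensor_of_sliceLeft S fun γ => hS γ s s.2
  let ν : S →ₗ[k] C ⊗[k] S :=
    e.symm.toLinearMap ∘ₗ (M.coact ∘ₗ S.subtype).codRestrict _ hr
  have hν : S.subtype.lTensor C ∘ₗ ν = M.coact ∘ₗ S.subtype := by
    ext s
    exact congrArg Subtype.val (e.apply_symm_apply ⟨M.coact s, hr s⟩)
  { carrier := S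
    coact := ν
    coassoc := by
      -- The identity is inherited from `M` through the injection of `C ⊗ C ⊗ S` into `C ⊗ C ⊗ M`.
      have hi : Function.Injective ((S.subtype.lTensor C).lTensor C) :=
        lTensor_injective C (lTensor_injective C S.subtype_injective)
      have h1 : (S.subtype.lTensor C).lTensor C ∘ₗ (TensorProduct.assoc k C C S).toLinearMap =
          (TensorProduct.assoc k C C M.carrier).toLinearMap ∘ₗ S.subtype.lTensor (C ⊗[k] C) := by
        ext; simp
      have h2 : S.subtype.lTensor (C ⊗[k] C) ∘ₗ
          (Coalgebra.comul (R := k) (A := C)).rTensor S =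
          (Coalgebra.comul (R := k) (A := C)).rTensor M.carrier ∘ₗ S.subtype.lTensor C := by
        ext; simp
      rw [← LinearMap.cancel_left hi, ← LinearMap.comp_assoc, h1, LinearMap.comp_assoc,
        ← LinearMap.comp_assoc ν, h2, LinearMap.comp_assoc ν, hν, ← LinearMap.comp_assoc ν,
        ← LinearMap.lTensor_comp, hν, LinearMap.lTensor_comp, LinearMap.comp_assoc ν, hν,
        ← LinearMap.comp_assoc S.subtype M.coact (M.coact.lTensor C), ← M.coassoc]
      simp only [LinearMap.comp_assoc]
    counit_coact := by
      have hi : Function.Injective (S.subtype.lTensor k) :=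
        lTensor_injective k S.subtype_injective
      rw [← LinearMap.cancel_left hi, ← LinearMap.comp_assoc]
      have h2 : S.subtype.lTensor k ∘ₗ (Coalgebra.counit (R := k) (A := C)).rTensor S =
          (Coalgebra.counit (R := k) (A := C)).rTensor M.carrier ∘ₗ S.subtype.lTensor C := by
        ext; simp
      rw [h2, LinearMap.comp_assoc, hν, ← LinearMap.comp_assoc, M.counit_coact]
      ext; simp }

theorem lTensor_sub_coact (M : LeftComodule k C) (S : Submodule k M.carrier)
    (hS : ∀ γ, ∀ m ∈ S, M.act γ m ∈ S) (s : S) :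
    S.subtype.lTensor C ((M.sub S hS).coact s) = M.coact s :=
  congrArg Subtype.val (LinearEquiv.apply_symm_apply
    (LinearEquiv.ofInjective (S.subtype.lTensor C) (lTensor_injective C S.subtype_injective))
    ⟨M.coact s, mem_range_lTensor_of_sliceLeft S fun γ => hS γ s s.2⟩)

/-- The inclusion of a subcomodule. -/
noncomputable def incl (M : LeftComodule k C) (S : Submodule k M.carrier)
    (hS : ∀ γ, ∀ m ∈ S, M.act γ m ∈ S) : M.sub S hS ⟶ M :=
  LeftComodule.Hom.mk S.subtype <| by
    ext s
    exact (M.lTensor_sub_coact S hS s).symm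

theorem hom_act {L M : LeftComodule k C} (f : L ⟶ M) (γ : Module.Dual k C) (x : L.carrier) :
    f.toLin (L.act γ x) = M.act γ (f.toLin x) := by
  have h := LinearMap.congr_fun f.comm x
  simp only [LinearMap.comp_apply] at h
  simp only [act, LinearMap.comp_apply, h, sliceLeft_lTensor]

/-- A linear map commuting with the action of the dual algebra is a comodule morphism. -/
def homOfAct {L M : LeftComodule k C} (f : L.carrier →ₗ[k] M.carrier)
    (h : ∀ γ x, f (L.act γ x) = M.act γ (f x)) : L ⟶ M :=
  LeftComodule.Hom.mk f <| by
    ext x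
    refine sliceLeft_ext fun γ => ?_
    simp only [LinearMap.comp_apply, sliceLeft_lTensor]
    exact (h γ x).symm

/-- Local finiteness. The orbit of `m` under the dual algebra lies in the finite-dimensional span of
the right tensor legs of its coaction. It contains `m` because the counit acts as the identity, and
its span is stable by `act_act`. Finite sums then cover every finite-dimensional `W`. -/
theorem exists_finite_sub (M : LeftComodule k C) (W : Submodule k M.carrier)
    (hW : Module.Finite k W) : ∃ S : Submodule k M.carrier, W ≤ S ∧ Module.Finite k S ∧
      ∀ γ, ∀ m ∈ S, M.act γ m ∈ S := by
  rw [Module.Finite.iff_fg] at hW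
  induction W, hW using Submodule.fg_induction with
  | singleton m =>
    let S : Submodule k M.carrier := Submodule.span k (Set.range fun γ => M.act γ m)
    refine ⟨S, ?_, ?_, ?_⟩
    · rw [Submodule.span_singleton_le_iff_mem]
      exact Submodule.subset_span ⟨Coalgebra.counit, M.act_counit m⟩
    · obtain ⟨T, hT, h⟩ := exists_finite_sliceLeft (M.coact m)
      have : S ≤ T := Submodule.span_le.2 (by rintro _ ⟨γ, rfl⟩; exact h γ)
      exact Submodule.finiteDimensional_of_le this
    · intro γ x hx
      induction hx using Submodule.span_induction with
      | mem x hx =>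
        obtain ⟨γ', rfl⟩ := hx
        dsimp only
        rw [act_act]
        exact Submodule.subset_span ⟨_, rfl⟩
      | zero => rw [map_zero]; exact S.zero_mem
      | add x y _ _ hx hy => rw [map_add]; exact S.add_mem hx hy
      | smul a x _ hx => rw [map_smul]; exact S.smul_mem a hx
  | sup W₁ W₂ _ _ h₁ h₂ =>
    obtain ⟨S₁, l₁, f₁, a₁⟩ := h₁
    obtain ⟨S₂, l₂, f₂, a₂⟩ := h₂
    refine ⟨S₁ ⊔ S₂, sup_le_sup l₁ l₂, inferInstance, fun γ x hx => ?_⟩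
    obtain ⟨y, hy, z, hz, rfl⟩ := Submodule.mem_sup.1 hx
    rw [map_add]
    exact Submodule.add_mem_sup (a₁ γ y hy) (a₂ γ z hz)

theorem act_mem_ker {L M : LeftComodule k C} (f : L ⟶ M) (γ : Module.Dual k C) (x : L.carrier)
    (hx : x ∈ LinearMap.ker f.toLin) : L.act γ x ∈ LinearMap.ker f.toLin := by
  rw [LinearMap.mem_ker] at hx ⊢
  rw [hom_act, hx, map_zero]

/-- The kernel is a subcomodule, and its inclusion and the zero map have the same composite with
`f`. -/
theorem injective_of_mono {L M : LeftComodule k C} (f : L ⟶ M) [Mono f] :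
    Function.Injective f.toLin := by
  rw [← LinearMap.ker_eq_bot, Submodule.eq_bot_iff]
  intro x hx
  let K := L.sub (LinearMap.ker f.toLin) fun γ => act_mem_ker f γ
  let z : K ⟶ L := LeftComodule.Hom.mk 0 (by simp)
  have h : L.incl (LinearMap.ker f.toLin) (fun γ => act_mem_ker f γ) = z := by
    rw [← cancel_mono f]
    apply LeftComodule.Hom.ext
    ext y
    exact y.2.trans (map_zero f.toLin).symm
  exact LinearMap.congr_fun (congrArg LeftComodule.Hom.toLin h) ⟨x, hx⟩

theorem mono_of_injective {L M : LeftComodule k C} (f : L ⟶ M)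
    (hf : Function.Injective f.toLin) : Mono f where
  right_cancellation g h e := by
    apply LeftComodule.Hom.ext
    ext x
    exact hf (LinearMap.congr_fun (congrArg LeftComodule.Hom.toLin e) x)

end LeftComodule

/-! ### Right comodules as locally finite modules -/

namespace RightComodule

/-- The action of the dual algebra on a right comodule. -/
noncomputable def act (N : RightComodule k C) (γ : Module.Dual k C) :
    N.carrier →ₗ[k] N.carrier :=
  sliceRight N.carrier γ ∘ₗ N.coact

theorem act_counit (N : RightComodule k C) (n : N.carrier) :
    N.act Coalgebra.counit n = n := by
  have h := LinearMap.congr_fun N.counit_coact n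
  simp only [LinearMap.comp_apply] at h
  simp [act, sliceRight, h]

/-- The convolution factors appear in the opposite order from the left comodule case. -/
theorem act_act (N : RightComodule k C) (γ γ' : Module.Dual k C) (n : N.carrier) :
    N.act γ' (N.act γ n) =
      N.act (LinearMap.mul' k k ∘ₗ TensorProduct.map γ' γ ∘ₗ Coalgebra.comul) n := by
  have h := LinearMap.congr_fun N.coassoc n
  simp only [LinearMap.comp_apply, LinearEquiv.coe_coe] at h
  simp only [act, LinearMap.comp_apply]
  rw [← sliceRight_rTensor, ← (TensorProduct.assoc k N.carrier C C).symm_apply_apply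
    (N.coact.rTensor C (N.coact n)), h]
  generalize N.coact n = x
  induction x with
  | zero => simp
  | add x y hx hy => simp only [map_add, hx, hy]
  | tmul n c =>
    simp only [LinearMap.lTensor_tmul, sliceRight_tmul, LinearMap.comp_apply]
    generalize Coalgebra.comul (R := k) c = y
    induction y with
    | zero => simp
    | add x y hx hy => simp only [map_add, TensorProduct.tmul_add, hx, hy, add_smul]
    | tmul a b => simp [smul_smul, mul_comm]

/-- The subcomodule on a subspace that is stable under the dual algebra. -/
noncomputable def sub (N : RightComodule k C) (S : Submodule k N.carrier)
    (hS : ∀ γ, ∀ n ∈ S, N.act γ n ∈ S) : RightComodule k C :=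
  let e := LinearEquiv.ofInjective (S.subtype.rTensor C) (rTensor_injective C S.subtype_injective)
  have hr : ∀ s : S, N.coact s ∈ LinearMap.range (S.subtype.rTensor C) := fun s =>
    mem_range_rTensor_of_sliceRight S fun γ => hS γ s s.2
  let ν : S →ₗ[k] S ⊗[k] C :=
    e.symm.toLinearMap ∘ₗ (N.coact ∘ₗ S.subtype).codRestrict _ hr
  have hν : S.subtype.rTensor C ∘ₗ ν = N.coact ∘ₗ S.subtype := by
    ext s
    exact congrArg Subtype.val (e.apply_symm_apply ⟨N.coact s, hr s⟩)
  { carrier := S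
    coact := ν
    coassoc := by
      have hi : Function.Injective (S.subtype.rTensor (C ⊗[k] C)) :=
        rTensor_injective _ S.subtype_injective
      have h1 : S.subtype.rTensor (C ⊗[k] C) ∘ₗ (TensorProduct.assoc k S C C).toLinearMap =
          (TensorProduct.assoc k N.carrier C C).toLinearMap ∘ₗ
            (S.subtype.rTensor C).rTensor C := by
        ext; simp
      have h2 : S.subtype.rTensor (C ⊗[k] C) ∘ₗ
          (Coalgebra.comul (R := k) (A := C)).lTensor S =
          (Coalgebra.comul (R := k) (A := C)).lTensor N.carrier ∘ₗ S.subtype.rTensor C := by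
        ext; simp
      rw [← LinearMap.cancel_left hi, ← LinearMap.comp_assoc, h1, LinearMap.comp_assoc,
        ← LinearMap.comp_assoc ν, ← LinearMap.rTensor_comp, hν, LinearMap.rTensor_comp,
        LinearMap.comp_assoc ν, hν, ← LinearMap.comp_assoc ν, h2, LinearMap.comp_assoc ν, hν,
        ← LinearMap.comp_assoc, ← LinearMap.comp_assoc, ← LinearMap.comp_assoc, ← N.coassoc]
      simp only [LinearMap.comp_assoc]
    counit_coact := by
      have hi : Function.Injective (S.subtype.rTensor k) :=
        rTensor_injective k S.subtype_injective
      rw [← LinearMap.cancel_left hi, ← LinearMap.comp_assoc]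
      have h2 : S.subtype.rTensor k ∘ₗ (Coalgebra.counit (R := k) (A := C)).lTensor S =
          (Coalgebra.counit (R := k) (A := C)).lTensor N.carrier ∘ₗ S.subtype.rTensor C := by
        ext; simp
      rw [h2, LinearMap.comp_assoc, hν, ← LinearMap.comp_assoc, N.counit_coact]
      ext; simp }

theorem rTensor_sub_coact (N : RightComodule k C) (S : Submodule k N.carrier)
    (hS : ∀ γ, ∀ n ∈ S, N.act γ n ∈ S) (s : S) :
    S.subtype.rTensor C ((N.sub S hS).coact s) = N.coact s :=
  congrArg Subtype.val (LinearEquiv.apply_symm_apply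
    (LinearEquiv.ofInjective (S.subtype.rTensor C) (rTensor_injective C S.subtype_injective))
    ⟨N.coact s, mem_range_rTensor_of_sliceRight S fun γ => hS γ s s.2⟩)

/-- The inclusion of a subcomodule. -/
noncomputable def incl (N : RightComodule k C) (S : Submodule k N.carrier)
    (hS : ∀ γ, ∀ n ∈ S, N.act γ n ∈ S) : N.sub S hS ⟶ N :=
  RightComodule.Hom.mk S.subtype <| by
    ext s
    exact (N.rTensor_sub_coact S hS s).symm

theorem hom_act {L N : RightComodule k C} (f : L ⟶ N) (γ : Module.Dual k C) (x : L.carrier) :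
    f.toLin (L.act γ x) = N.act γ (f.toLin x) := by
  have h := LinearMap.congr_fun f.comm x
  simp only [LinearMap.comp_apply] at h
  simp only [act, LinearMap.comp_apply, h, sliceRight_rTensor]

/-- A linear map commuting with the action of the dual algebra is a comodule morphism. -/
def homOfAct {L N : RightComodule k C} (f : L.carrier →ₗ[k] N.carrier)
    (h : ∀ γ x, f (L.act γ x) = N.act γ (f x)) : L ⟶ N :=
  RightComodule.Hom.mk f <| by
    ext x
    refine sliceRight_ext fun γ => ?_
    simp only [LinearMap.comp_apply, sliceRight_rTensor]
    exact (h γ x).symm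

theorem exists_finite_sub (N : RightComodule k C) (W : Submodule k N.carrier)
    (hW : Module.Finite k W) : ∃ S : Submodule k N.carrier, W ≤ S ∧ Module.Finite k S ∧
      ∀ γ, ∀ n ∈ S, N.act γ n ∈ S := by
  rw [Module.Finite.iff_fg] at hW
  induction W, hW using Submodule.fg_induction with
  | singleton n =>
    let S : Submodule k N.carrier := Submodule.span k (Set.range fun γ => N.act γ n)
    refine ⟨S, ?_, ?_, ?_⟩
    · rw [Submodule.span_singleton_le_iff_mem]
      exact Submodule.subset_span ⟨Coalgebra.counit, N.act_counit n⟩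
    · obtain ⟨T, hT, h⟩ := exists_finite_sliceRight (N.coact n)
      have : S ≤ T := Submodule.span_le.2 (by rintro _ ⟨γ, rfl⟩; exact h γ)
      exact Submodule.finiteDimensional_of_le this
    · intro γ x hx
      induction hx using Submodule.span_induction with
      | mem x hx =>
        obtain ⟨γ', rfl⟩ := hx
        dsimp only
        rw [act_act]
        exact Submodule.subset_span ⟨_, rfl⟩
      | zero => rw [map_zero]; exact S.zero_mem
      | add x y _ _ hx hy => rw [map_add]; exact S.add_mem hx hy
      | smul a x _ hx => rw [map_smul]; exact S.smul_mem a hx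
  | sup W₁ W₂ _ _ h₁ h₂ =>
    obtain ⟨S₁, l₁, f₁, a₁⟩ := h₁
    obtain ⟨S₂, l₂, f₂, a₂⟩ := h₂
    refine ⟨S₁ ⊔ S₂, sup_le_sup l₁ l₂, inferInstance, fun γ x hx => ?_⟩
    obtain ⟨y, hy, z, hz, rfl⟩ := Submodule.mem_sup.1 hx
    rw [map_add]
    exact Submodule.add_mem_sup (a₁ γ y hy) (a₂ γ z hz)

theorem act_mem_ker {L N : RightComodule k C} (f : L ⟶ N) (γ : Module.Dual k C) (x : L.carrier)
    (hx : x ∈ LinearMap.ker f.toLin) : L.act γ x ∈ LinearMap.ker f.toLin := by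
  rw [LinearMap.mem_ker] at hx ⊢
  rw [hom_act, hx, map_zero]

theorem act_mem_range {L N : RightComodule k C} (f : L ⟶ N) (γ : Module.Dual k C)
    (x : N.carrier) (hx : x ∈ LinearMap.range f.toLin) :
    N.act γ x ∈ LinearMap.range f.toLin := by
  obtain ⟨y, rfl⟩ := hx
  exact ⟨L.act γ y, hom_act f γ y⟩

end RightComodule

end Contra

namespace Contra

variable {k C : Type u} [Field k] [AddCommGroup C] [Module k C] [Coalgebra k C]

/-! ### The defining differences on generators -/

theorem cohomDiff_apply (M : LeftComodule k C) (P : LeftContramodule k C)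
    (g : C ⊗[k] M.carrier →ₗ[k] P.carrier) (m : M.carrier) :
    cohomDiff M P g m = g (M.coact m) - P.contract ((TensorProduct.curry g).flip m) :=
  rfl

theorem contratensorDiff_tmul (N : RightComodule k C) (P : LeftContramodule k C)
    (n : N.carrier) (f : C →ₗ[k] P.carrier) :
    contratensorDiff N P (n ⊗ₜ f) = f.lTensor N.carrier (N.coact n) - n ⊗ₜ P.contract f := by
  simp only [contratensorDiff, LinearMap.sub_apply, LinearMap.comp_apply, LinearMap.rTensor_tmul,
    LinearMap.lTensor_tmul, LinearEquiv.coe_coe]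
  congr 1
  generalize N.coact n = x
  induction x with
  | zero => simp
  | add x y hx hy => simp only [map_add, TensorProduct.add_tmul, hx, hy]
  | tmul a b => simp

theorem cotensorDiff_tmul (N : RightComodule k C) (M : LeftComodule k C)
    (n : N.carrier) (m : M.carrier) :
    cotensorDiff N M (n ⊗ₜ m) =
      TensorProduct.assoc k N.carrier C M.carrier (N.coact n ⊗ₜ m) - n ⊗ₜ M.coact m := by
  simp [cotensorDiff]

/-! ### Duality for finite-dimensional comodules -/

section Pairing

variable {M : LeftComodule k C} {N : RightComodule k C}
  (b : N.carrier ≃ₗ[k] Module.Dual k M.carrier)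

/-- The map `N ⊗ V → Hom(M, V)` defined by a pairing of `N` and `M`. -/
noncomputable def pairHom (V : Type u) [AddCommGroup V] [Module k V] :
    N.carrier ⊗[k] V →ₗ[k] (M.carrier →ₗ[k] V) :=
  dualTensorHom k M.carrier V ∘ₗ b.toLinearMap.rTensor V

variable {V W : Type u} [AddCommGroup V] [Module k V] [AddCommGroup W] [Module k W]

@[simp]
theorem pairHom_tmul (n : N.carrier) (v : V) (m : M.carrier) :
    pairHom b V (n ⊗ₜ v) m = b n m • v := by
  simp [pairHom]

theorem pairHom_bijective [Module.Finite k M.carrier] : Function.Bijective (pairHom b V) := by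
  have h : Function.Bijective (b.toLinearMap.rTensor V) := (b.rTensor V).bijective
  exact (dualTensorHom_bijective (R := k) (M := M.carrier) (N := V)).comp h

theorem pairHom_lTensor (f : V →ₗ[k] W) (x : N.carrier ⊗[k] V) :
    pairHom b W (f.lTensor N.carrier x) = f ∘ₗ pairHom b V x := by
  ext m
  induction x with
  | zero => simp
  | add x y hx hy => simp_all
  | tmul n v => simp

theorem pairHom_apply_eq_sliceLeft (x : N.carrier ⊗[k] V) (m : M.carrier) :
    pairHom b V x m = sliceLeft V (b.toLinearMap.flip m) x := by
  induction x with
  | zero => simp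
  | add x y hx hy => simp_all
  | tmul n v => simp

/-- The pairing `b` is compatible with the coactions. -/
def CoactCompatible : Prop :=
  ∀ n m, sliceRight C (b n) (M.coact m) = sliceLeft C (b.toLinearMap.flip m) (N.coact n)

variable {b}

theorem pairHom_contratensorDiff (hb : CoactCompatible b) (P : LeftContramodule k C)
    (x : N.carrier ⊗[k] (C →ₗ[k] P.carrier)) :
    pairHom b P.carrier (contratensorDiff N P x) =
      cohomDiff M P (TensorProduct.lift (pairHom b _ x).flip) := by
  induction x with
  | zero =>
    have : TensorProduct.lift (pairHom b (C →ₗ[k] P.carrier) 0).flip = 0 := by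
      ext; simp
    rw [this, map_zero, map_zero, map_zero]
  | add x y hx hy =>
    have : TensorProduct.lift (pairHom b _ (x + y)).flip =
        TensorProduct.lift (pairHom b _ x).flip + TensorProduct.lift (pairHom b _ y).flip := by
      ext; simp
    rw [this, map_add, map_add, map_add, hx, hy]
  | tmul n f =>
    ext m
    rw [contratensorDiff_tmul, map_sub, pairHom_lTensor, cohomDiff_apply, LinearMap.sub_apply,
      LinearMap.comp_apply, pairHom_apply_eq_sliceLeft, ← hb n m, pairHom_tmul]
    congr 1
    · generalize M.coact m = y
      induction y with
      | zero => simp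
      | add x y hx hy => simp only [map_add, hx, hy]
      | tmul c m => simp
    · rw [← map_smul]
      exact congrArg P.contract (by ext c; simp)

/-- This is `N ⊙ P = Cohom_C(M, P)` for `N` dual to `M`. `pairHom` is bijective with coefficients in
`P` and in `Hom(C, P)`, and it intertwines the two differences. -/
theorem mem_range_contratensorDiff_iff [Module.Finite k M.carrier] (hb : CoactCompatible b)
    (P : LeftContramodule k C) (x : N.carrier ⊗[k] P.carrier) :
    x ∈ LinearMap.range (contratensorDiff N P) ↔
      pairHom b P.carrier x ∈ LinearMap.range (cohomDiff M P) := by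
  constructor
  · rintro ⟨y, rfl⟩
    exact ⟨_, (pairHom_contratensorDiff hb P y).symm⟩
  · rintro ⟨g, hg⟩
    obtain ⟨y, hy⟩ := (pairHom_bijective b (V := C →ₗ[k] P.carrier)).2 (TensorProduct.curry g).flip
    refine ⟨y, (pairHom_bijective b).1 ?_⟩
    rw [pairHom_contratensorDiff hb, hy, ← hg]
    congr 1
    ext
    simp

theorem pairHom_cotensorDiff (hb : CoactCompatible b) (L : LeftComodule k C)
    (x : N.carrier ⊗[k] L.carrier) :
    pairHom b _ (cotensorDiff N L x) =
      (pairHom b L.carrier x).lTensor C ∘ₗ M.coact - L.coact ∘ₗ pairHom b L.carrier x := by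
  induction x with
  | zero => simp
  | add x y hx hy =>
    rw [map_add, map_add, map_add, hx, hy, LinearMap.lTensor_add, LinearMap.add_comp,
      LinearMap.comp_add, add_sub_add_comm]
  | tmul n l =>
    ext m
    rw [cotensorDiff_tmul, map_sub, LinearMap.sub_apply, LinearMap.sub_apply, LinearMap.comp_apply,
      LinearMap.comp_apply, pairHom_tmul, pairHom_tmul, map_smul]
    congr 1
    trans (sliceRight C (b n) (M.coact m)) ⊗ₜ l
    · rw [hb n m]
      generalize N.coact n = y
      induction y with
      | zero => simp
      | add x y hx hy =>
        simp only [map_add, TensorProduct.add_tmul, LinearMap.add_apply, hx, hy]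
      | tmul n c => simp [TensorProduct.smul_tmul']
    · generalize M.coact m = y
      induction y with
      | zero => simp
      | add x y hx hy => simp only [map_add, TensorProduct.add_tmul, hx, hy]
      | tmul c m => simp [TensorProduct.smul_tmul]

/-- This is `N □ L = Hom_C(M, L)` for `N` dual to `M`: the cotensor difference becomes the failure
of colinearity. -/
theorem mem_cotensor_iff [Module.Finite k M.carrier] (hb : CoactCompatible b)
    (L : LeftComodule k C) (x : N.carrier ⊗[k] L.carrier) :
    x ∈ cotensor N L ↔
      L.coact ∘ₗ pairHom b L.carrier x = (pairHom b L.carrier x).lTensor C ∘ₗ M.coact := by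
  rw [cotensor, LinearMap.mem_ker, ← (pairHom_bijective b).1.eq_iff, pairHom_cotensorDiff hb,
    map_zero, sub_eq_zero, eq_comm]

end Pairing

/-! ### Dual comodules of finite-dimensional comodules -/

namespace LeftComodule

variable (M : LeftComodule k C) [Module.Finite k M.carrier]

/-- The coaction on the dual space of a finite-dimensional left comodule. -/
noncomputable def dualCoact :
    Module.Dual k M.carrier →ₗ[k] Module.Dual k M.carrier ⊗[k] C :=
  (LinearEquiv.ofBijective (dualTensorHom k M.carrier C) dualTensorHom_bijective).symm ∘ₗ
    { toFun := fun φ => sliceRight C φ ∘ₗ M.coact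
      map_add' := fun φ ψ => by simp [sliceRight, LinearMap.comp_add, LinearMap.add_comp]
      map_smul' := fun a φ => by simp [sliceRight, LinearMap.comp_smul, LinearMap.smul_comp] }

theorem dualTensorHom_dualCoact (φ : Module.Dual k M.carrier) :
    dualTensorHom k M.carrier C (M.dualCoact φ) = sliceRight C φ ∘ₗ M.coact :=
  (LinearEquiv.ofBijective (dualTensorHom k M.carrier C) dualTensorHom_bijective).apply_symm_apply _

/-- The dual right comodule of a finite-dimensional left comodule. -/
noncomputable def dual : RightComodule k C where
  carrier := Module.Dual k M.carrier
  coact := M.dualCoact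
  coassoc := by
    ext φ : 1
    -- Elements of `M^* ⊗ (C ⊗ C)` are compared as maps `M → C ⊗ C`; there the identity is the
    -- coassociativity of `M` contracted with `φ`.
    apply (dualTensorHom_bijective (R := k) (M := M.carrier) (N := C ⊗[k] C)).1
    ext m : 1
    have h₁ : ∀ x : Module.Dual k M.carrier ⊗[k] C, dualTensorHom k M.carrier (C ⊗[k] C)
        (TensorProduct.assoc k _ C C (M.dualCoact.rTensor C x)) m =
        (dualTensorHom k M.carrier C x).lTensor C (M.coact m) := by
      intro x
      induction x with
      | zero => simp
      | add x y hx hy => simp only [map_add, LinearMap.add_apply, LinearMap.lTensor_add, hx, hy]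
      | tmul φ c =>
        have h₂ : ∀ y : Module.Dual k M.carrier ⊗[k] C, dualTensorHom k M.carrier (C ⊗[k] C)
            (TensorProduct.assoc k _ C C (y ⊗ₜ c)) m = dualTensorHom k M.carrier C y m ⊗ₜ c := by
          intro y
          induction y with
          | zero => simp
          | add x y hx hy => simp only [map_add, LinearMap.add_apply, TensorProduct.add_tmul, hx, hy]
          | tmul φ d => simp [TensorProduct.smul_tmul']
        rw [LinearMap.rTensor_tmul, h₂, dualTensorHom_dualCoact, LinearMap.comp_apply]
        generalize M.coact m = y
        induction y with
        | zero => simp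
        | add x y hx hy => simp only [map_add, TensorProduct.add_tmul, hx, hy]
        | tmul d m => simp [TensorProduct.smul_tmul]
    have h₃ : ∀ x : Module.Dual k M.carrier ⊗[k] C, dualTensorHom k M.carrier (C ⊗[k] C)
        ((Coalgebra.comul (R := k) (A := C)).lTensor _ x) m =
        Coalgebra.comul (R := k) (dualTensorHom k M.carrier C x m) := by
      intro x
      induction x with
      | zero => simp
      | add x y hx hy => simp only [map_add, LinearMap.add_apply, hx, hy]
      | tmul φ c => simp
    simp only [LinearMap.comp_apply, LinearEquiv.coe_coe]
    rw [h₁, h₃, dualTensorHom_dualCoact, LinearMap.lTensor_comp_apply, LinearMap.comp_apply]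
    have h := LinearMap.congr_fun M.coassoc m
    simp only [LinearMap.comp_apply, LinearEquiv.coe_coe] at h
    rw [← h]
    generalize M.coact m = y
    induction y with
    | zero => simp
    | add x y hx hy => simp only [map_add, hx, hy]
    | tmul c m =>
      simp only [LinearMap.rTensor_tmul, sliceRight_tmul, map_smul]
      generalize Coalgebra.comul (R := k) c = z
      induction z with
      | zero => simp
      | add x y hx hy => simp only [map_add, TensorProduct.add_tmul, hx, hy, smul_add]
      | tmul c m => simp
  counit_coact := by
    ext φ : 1
    apply (dualTensorHom_bijective (R := k) (M := M.carrier) (N := k)).1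
    ext m : 1
    have h₃ : ∀ x : Module.Dual k M.carrier ⊗[k] C, dualTensorHom k M.carrier k
        ((Coalgebra.counit (R := k) (A := C)).lTensor _ x) m =
        Coalgebra.counit (R := k) (dualTensorHom k M.carrier C x m) := by
      intro x
      induction x with
      | zero => simp
      | add x y hx hy => simp only [map_add, LinearMap.add_apply, hx, hy]
      | tmul φ c => simp
    rw [LinearMap.comp_apply, h₃, dualTensorHom_dualCoact, LinearMap.comp_apply]
    have h := LinearMap.congr_fun M.counit_coact m
    have h' : ∀ y, Coalgebra.counit (R := k) (sliceRight C φ y) =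
        φ (sliceLeft M.carrier Coalgebra.counit y) := by
      intro y
      induction y with
      | zero => simp
      | add x y hx hy => simp only [map_add, hx, hy]
      | tmul c m => simp [mul_comm]
    simp only [LinearMap.comp_apply] at h
    rw [h', sliceLeft, LinearMap.comp_apply, h]
    simp

theorem dual_coactCompatible :
    CoactCompatible (M := M) (N := M.dual) (LinearEquiv.refl k (Module.Dual k M.carrier)) := by
  intro φ m
  have h := LinearMap.congr_fun (M.dualTensorHom_dualCoact φ) m
  rw [LinearMap.comp_apply] at h
  have h' : ∀ x : Module.Dual k M.carrier ⊗[k] C,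
      dualTensorHom k M.carrier C x m = sliceLeft C (Module.Dual.eval k M.carrier m) x := by
    intro x
    induction x with
    | zero => simp
    | add x y hx hy => simp only [map_add, LinearMap.add_apply, hx, hy]
    | tmul φ c => simp
  exact h.symm.trans (h' _)

variable {M}

theorem dualCoact_dualMap {L : LeftComodule k C} [Module.Finite k L.carrier] (f : L ⟶ M)
    (φ : Module.Dual k M.carrier) :
    L.dualCoact (f.toLin.dualMap φ) = f.toLin.dualMap.rTensor C (M.dualCoact φ) := by
  apply (dualTensorHom_bijective (R := k) (M := L.carrier) (N := C)).1
  have h : ∀ x, dualTensorHom k L.carrier C (f.toLin.dualMap.rTensor C x) =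
      dualTensorHom k M.carrier C x ∘ₗ f.toLin := by
    intro x
    induction x with
    | zero => simp
    | add x y hx hy => simp only [map_add, LinearMap.add_comp, hx, hy]
    | tmul φ c => ext; simp
  rw [h, dualTensorHom_dualCoact, dualTensorHom_dualCoact, LinearMap.comp_assoc, f.comm]
  ext x
  simp only [LinearMap.comp_apply]
  generalize L.coact x = y
  induction y with
  | zero => simp
  | add x y hx hy => simp only [map_add, hx, hy]
  | tmul c m => simp

/-- The transpose of a morphism of finite-dimensional left comodules. -/
noncomputable def dualMap {L : LeftComodule k C} [Module.Finite k L.carrier] (f : L ⟶ M) :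
    M.dual ⟶ L.dual :=
  RightComodule.Hom.mk f.toLin.dualMap (LinearMap.ext fun φ => dualCoact_dualMap f φ)

end LeftComodule

namespace RightComodule

variable (N : RightComodule k C) [Module.Finite k N.carrier]

/-- The map `V ⊗ N^* → Hom(N, V)` for a finite-dimensional right comodule `N`. -/
noncomputable def tensorDualHom (V : Type u) [AddCommGroup V] [Module k V] :
    V ⊗[k] Module.Dual k N.carrier ≃ₗ[k] (N.carrier →ₗ[k] V) :=
  TensorProduct.comm k V _ ≪≫ₗ
    LinearEquiv.ofBijective (dualTensorHom k N.carrier V) dualTensorHom_bijective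

@[simp]
theorem tensorDualHom_tmul {V : Type u} [AddCommGroup V] [Module k V] (v : V)
    (φ : Module.Dual k N.carrier) (n : N.carrier) :
    N.tensorDualHom V (v ⊗ₜ φ) n = φ n • v := by
  simp [tensorDualHom]

/-- The coaction on the dual space of a finite-dimensional right comodule. -/
noncomputable def dualCoact :
    Module.Dual k N.carrier →ₗ[k] C ⊗[k] Module.Dual k N.carrier :=
  (N.tensorDualHom C).symm ∘ₗ
    { toFun := fun φ => sliceLeft C φ ∘ₗ N.coact
      map_add' := fun φ ψ => by simp [sliceLeft, LinearMap.comp_add, LinearMap.add_comp]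
      map_smul' := fun a φ => by simp [sliceLeft, LinearMap.comp_smul, LinearMap.smul_comp] }

theorem tensorDualHom_dualCoact (φ : Module.Dual k N.carrier) :
    N.tensorDualHom C (N.dualCoact φ) = sliceLeft C φ ∘ₗ N.coact :=
  (N.tensorDualHom C).apply_symm_apply _

/-- The dual left comodule of a finite-dimensional right comodule. -/
noncomputable def dual : LeftComodule k C where
  carrier := Module.Dual k N.carrier
  coact := N.dualCoact
  coassoc := by
    ext φ : 1
    apply (TensorProduct.assoc k C C (Module.Dual k N.carrier)).symm.injective
    apply (N.tensorDualHom (C ⊗[k] C)).injective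
    ext n : 1
    have h₁ : ∀ x : C ⊗[k] Module.Dual k N.carrier, N.tensorDualHom (C ⊗[k] C)
        ((TensorProduct.assoc k C C _).symm (N.dualCoact.lTensor C x)) n =
        (N.tensorDualHom C x).rTensor C (N.coact n) := by
      intro x
      induction x with
      | zero => simp
      | add x y hx hy => simp only [map_add, LinearMap.add_apply, LinearMap.rTensor_add, hx, hy]
      | tmul c φ =>
        have h₂ : ∀ y : C ⊗[k] Module.Dual k N.carrier, N.tensorDualHom (C ⊗[k] C)
            ((TensorProduct.assoc k C C _).symm (c ⊗ₜ y)) n = c ⊗ₜ N.tensorDualHom C y n := by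
          intro y
          induction y with
          | zero => simp
          | add x y hx hy => simp only [map_add, LinearMap.add_apply, TensorProduct.tmul_add, hx, hy]
          | tmul d φ => simp
        rw [LinearMap.lTensor_tmul, h₂, tensorDualHom_dualCoact, LinearMap.comp_apply]
        generalize N.coact n = y
        induction y with
        | zero => simp
        | add x y hx hy => simp only [map_add, TensorProduct.tmul_add, hx, hy]
        | tmul n d => simp [TensorProduct.smul_tmul]
    have h₃ : ∀ x : C ⊗[k] Module.Dual k N.carrier, N.tensorDualHom (C ⊗[k] C)
        ((Coalgebra.comul (R := k) (A := C)).rTensor _ x) n =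
        Coalgebra.comul (R := k) (N.tensorDualHom C x n) := by
      intro x
      induction x with
      | zero => simp
      | add x y hx hy => simp only [map_add, LinearMap.add_apply, hx, hy]
      | tmul c φ => simp
    simp only [LinearMap.comp_apply, LinearEquiv.coe_coe, LinearEquiv.symm_apply_apply]
    rw [h₁, h₃, tensorDualHom_dualCoact, LinearMap.rTensor_comp_apply, LinearMap.comp_apply]
    have h := LinearMap.congr_fun N.coassoc n
    simp only [LinearMap.comp_apply, LinearEquiv.coe_coe] at h
    rw [← (TensorProduct.assoc k N.carrier C C).eq_symm_apply] at h
    rw [h]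
    generalize N.coact n = y
    induction y with
    | zero => simp
    | add x y hx hy => simp only [map_add, hx, hy]
    | tmul n c =>
      simp only [LinearMap.lTensor_tmul, sliceLeft_tmul, map_smul]
      generalize Coalgebra.comul (R := k) c = z
      induction z with
      | zero => simp
      | add x y hx hy => simp only [map_add, TensorProduct.tmul_add, hx, hy, smul_add]
      | tmul c d => simp [TensorProduct.smul_tmul']
  counit_coact := by
    ext φ : 1
    apply (N.tensorDualHom k).injective
    ext n : 1
    have h₃ : ∀ x : C ⊗[k] Module.Dual k N.carrier, N.tensorDualHom k
        ((Coalgebra.counit (R := k) (A := C)).rTensor _ x) n =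
        Coalgebra.counit (R := k) (N.tensorDualHom C x n) := by
      intro x
      induction x with
      | zero => simp
      | add x y hx hy => simp only [map_add, LinearMap.add_apply, hx, hy]
      | tmul c φ => simp
    rw [LinearMap.comp_apply, h₃, tensorDualHom_dualCoact, LinearMap.comp_apply]
    have h := LinearMap.congr_fun N.counit_coact n
    have h' : ∀ y, Coalgebra.counit (R := k) (sliceLeft C φ y) =
        φ (sliceRight N.carrier Coalgebra.counit y) := by
      intro y
      induction y with
      | zero => simp
      | add x y hx hy => simp only [map_add, hx, hy]
      | tmul n c => simp [mul_comm]
    simp only [LinearMap.comp_apply] at h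
    rw [h', sliceRight, LinearMap.comp_apply, h]
    simp

theorem dual_coactCompatible :
    CoactCompatible (M := N.dual) (N := N) (Module.evalEquiv k N.carrier) := by
  intro n φ
  have h := LinearMap.congr_fun (N.tensorDualHom_dualCoact φ) n
  rw [LinearMap.comp_apply] at h
  have h' : ∀ x : C ⊗[k] Module.Dual k N.carrier,
      sliceRight C (Module.Dual.eval k N.carrier n) x = N.tensorDualHom C x n := by
    intro x
    induction x with
    | zero => simp
    | add x y hx hy => simp only [map_add, LinearMap.add_apply, hx, hy]
    | tmul c φ => simp
  exact (h' _).trans h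

variable {N}

theorem dualCoact_dualMap {L : RightComodule k C} [Module.Finite k L.carrier] (f : L ⟶ N)
    (φ : Module.Dual k N.carrier) :
    L.dualCoact (f.toLin.dualMap φ) = f.toLin.dualMap.lTensor C (N.dualCoact φ) := by
  apply (L.tensorDualHom C).injective
  have h : ∀ x, L.tensorDualHom C (f.toLin.dualMap.lTensor C x) =
      N.tensorDualHom C x ∘ₗ f.toLin := by
    intro x
    induction x with
    | zero => simp
    | add x y hx hy => simp only [map_add, LinearMap.add_comp, hx, hy]
    | tmul φ c => ext; simp
  rw [h, tensorDualHom_dualCoact, tensorDualHom_dualCoact, LinearMap.comp_assoc, f.comm]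
  ext x
  simp only [LinearMap.comp_apply]
  generalize L.coact x = y
  induction y with
  | zero => simp
  | add x y hx hy => simp only [map_add, hx, hy]
  | tmul c m => simp

/-- The transpose of a morphism of finite-dimensional right comodules. -/
noncomputable def dualMap {L : RightComodule k C} [Module.Finite k L.carrier] (f : L ⟶ N) :
    N.dual ⟶ L.dual :=
  LeftComodule.Hom.mk f.toLin.dualMap (LinearMap.ext fun φ => dualCoact_dualMap f φ)

end RightComodule

end Contra

namespace Contra

/-! ### Splitting of short exact sequences of vector spaces -/

section Linear

variable {k : Type u} [Field k] {A B D X : Type u} [AddCommGroup A] [Module k A]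
  [AddCommGroup B] [Module k B] [AddCommGroup D] [Module k D] [AddCommGroup X] [Module k X]

theorem exists_section {g : B →ₗ[k] D} (hg : Function.Surjective g) :
    ∃ σ : D →ₗ[k] B, ∀ x, g (σ x) = x := by
  obtain ⟨σ, hσ⟩ := g.exists_rightInverse_of_surjective (LinearMap.range_eq_top.2 hg)
  exact ⟨σ, LinearMap.congr_fun hσ⟩

theorem exists_retraction {f : A →ₗ[k] B} (hf : Function.Injective f) :
    ∃ ρ : B →ₗ[k] A, ∀ x, ρ (f x) = x := by
  obtain ⟨ρ, hρ⟩ := f.exists_leftInverse_of_injective (LinearMap.ker_eq_bot.2 hf)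
  exact ⟨ρ, LinearMap.congr_fun hρ⟩

theorem exists_lift_of_exact {f : A →ₗ[k] B} {g : B →ₗ[k] D} (hf : Function.Injective f)
    (he : Function.Exact f g) (h : X →ₗ[k] B) (hh : g ∘ₗ h = 0) :
    ∃ h' : X →ₗ[k] A, f ∘ₗ h' = h := by
  obtain ⟨ρ, hρ⟩ := exists_retraction hf
  refine ⟨ρ ∘ₗ h, ?_⟩
  ext x
  obtain ⟨a, ha⟩ := (he (h x)).1 (LinearMap.congr_fun hh x)
  simp only [LinearMap.comp_apply, ← ha, hρ]

theorem exists_desc_of_exact {f : A →ₗ[k] B} {g : B →ₗ[k] D} (hg : Function.Surjective g)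
    (he : Function.Exact f g) (h : B →ₗ[k] X) (hh : h ∘ₗ f = 0) :
    ∃ h' : D →ₗ[k] X, h' ∘ₗ g = h := by
  obtain ⟨σ, hσ⟩ := exists_section hg
  refine ⟨h ∘ₗ σ, ?_⟩
  ext x
  obtain ⟨a, ha⟩ := (he (σ (g x) - x)).1 (by rw [map_sub, hσ, sub_self])
  have := LinearMap.congr_fun hh a
  simp only [LinearMap.comp_apply, ha, map_sub, LinearMap.zero_apply, sub_eq_zero] at this
  exact this

/-- Such an `h` factors through the range of `d`, and a map on a subspace extends to the whole
space. -/
theorem exists_factor_of_ker_le {h : B →ₗ[k] X} {d : B →ₗ[k] D}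
    (hh : ∀ x, d x = 0 → h x = 0) : ∃ h' : D →ₗ[k] X, h' ∘ₗ d = h := by
  obtain ⟨h₁, e₁⟩ := exists_desc_of_exact (f := (LinearMap.ker d).subtype) (g := d.rangeRestrict)
    d.surjective_rangeRestrict
    (LinearMap.exact_iff.2 (by rw [Submodule.range_subtype, LinearMap.ker_rangeRestrict]))
    h (by ext x; exact hh x x.2)
  obtain ⟨h₂, e₂⟩ := h₁.exists_extend
  refine ⟨h₂, ?_⟩
  ext x
  rw [← e₁, ← e₂]
  rfl

end Linear

variable {k C : Type u} [Field k] [AddCommGroup C] [Module k C] [Coalgebra k C]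

/-! ### One-sided exactness of the three functors -/

theorem cotensorMap_injective {N₁ N₂ : RightComodule k C} (f : N₁ ⟶ N₂)
    (hf : Function.Injective f.toLin) (M : LeftComodule k C) :
    Function.Injective (cotensorMap f M) := fun _ _ h =>
  Subtype.ext (rTensor_injective M.carrier hf (congrArg Subtype.val h))

/-- Exactness of the tensor product gives a preimage in `N₁ ⊗ M`. It lies in the cotensor product
because its difference dies under the injective map into `N₂ ⊗ (C ⊗ M)`. -/
theorem cotensorMap_exact {N₁ N₂ N₃ : RightComodule k C} {f : N₁ ⟶ N₂} {g : N₂ ⟶ N₃}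
    (h : ShortExactSeq f.toLin g.toLin) (M : LeftComodule k C) :
    Function.Exact (cotensorMap f M) (cotensorMap g M) := by
  have he := rTensor_exact M.carrier h.exact h.surjective
  rintro ⟨x, hx⟩
  constructor
  · intro hz
    obtain ⟨y, rfl⟩ := (he x).1 (congrArg Subtype.val hz)
    refine ⟨⟨y, ?_⟩, rfl⟩
    have hn := LinearMap.congr_fun (cotensorDiff_naturality f M) y
    simp only [LinearMap.comp_apply] at hn
    rw [cotensor, LinearMap.mem_ker] at hx ⊢
    apply rTensor_injective (C ⊗[k] M.carrier) h.injective
    rw [← hn, hx, map_zero]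
  · rintro ⟨y, hy⟩
    apply Subtype.ext
    exact (he x).2 ⟨y, congrArg Subtype.val hy⟩

/-- The cotensor product is left exact, so only lifting along surjections remains. -/
theorem Coflat.of_surjective {M : LeftComodule k C}
    (H : ∀ ⦃N N' : RightComodule k C⦄ (g : N ⟶ N'), Function.Surjective g.toLin →
      ∀ z ∈ cotensor N' M, ∃ y ∈ cotensor N M, g.toLin.rTensor M.carrier y = z) :
    Coflat M := fun _ _ _ f g h =>
  { injective := cotensorMap_injective f h.injective M
    exact := cotensorMap_exact h M
    surjective := fun ⟨z, hz⟩ => by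
      obtain ⟨y, hy, e⟩ := H g h.surjective z hz
      exact ⟨⟨y, hy⟩, Subtype.ext e⟩ }

theorem Coflat.exists_preimage {M : LeftComodule k C} (hM : Coflat M) {N N' : RightComodule k C}
    (g : N ⟶ N') (hg : Function.Surjective g.toLin) (z : N'.carrier ⊗[k] M.carrier)
    (hz : z ∈ cotensor N' M) : ∃ y ∈ cotensor N M, g.toLin.rTensor M.carrier y = z := by
  have h : ShortExactSeq
      (N.incl (LinearMap.ker g.toLin) (fun γ => RightComodule.act_mem_ker g γ)).toLin g.toLin :=
    { injective := Submodule.subtype_injective _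
      exact := LinearMap.exact_subtype_ker_map g.toLin
      surjective := hg }
  obtain ⟨y, hy⟩ := (hM _ g h).surjective ⟨z, hz⟩
  exact ⟨y.1, y.2, congrArg Subtype.val hy⟩

theorem cohomMapRight_surjective (M : LeftComodule k C) {P Q : LeftContramodule k C} (g : P ⟶ Q)
    (hg : Function.Surjective g.toLin) : Function.Surjective (cohomMapRight M g) := by
  intro x
  obtain ⟨h, rfl⟩ := Submodule.Quotient.mk_surjective _ x
  obtain ⟨σ, hσ⟩ := exists_section hg
  refine ⟨Submodule.Quotient.mk (σ ∘ₗ h), ?_⟩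
  refine congrArg Submodule.Quotient.mk ?_
  ext m
  exact hσ _

theorem cohomDiff_comp_right (M : LeftComodule k C) {P Q : LeftContramodule k C} (f : P ⟶ Q)
    (g : C ⊗[k] M.carrier →ₗ[k] P.carrier) :
    f.toLin ∘ₗ cohomDiff M P g = cohomDiff M Q (f.toLin ∘ₗ g) := by
  ext m
  simp only [LinearMap.comp_apply, cohomDiff_apply, map_sub, f.comm]
  rfl

theorem cohomDiff_comp_left {L M : LeftComodule k C} (f : L ⟶ M) (P : LeftContramodule k C)
    (g : C ⊗[k] M.carrier →ₗ[k] P.carrier) :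
    cohomDiff M P g ∘ₗ f.toLin = cohomDiff L P (g ∘ₗ f.toLin.lTensor C) := by
  ext m
  have h := LinearMap.congr_fun f.comm m
  simp only [LinearMap.comp_apply] at h
  simp only [LinearMap.comp_apply, cohomDiff_apply, h]
  rfl

/-- If `g ∘ φ` is the boundary of `q`, lift `q` along a linear section of `g`. Subtracting the
boundary of the lift from `φ` leaves a map killed by `g`, which factors through `P₁`. -/
theorem cohomMapRight_exact (M : LeftComodule k C) {P₁ P₂ P₃ : LeftContramodule k C}
    {f : P₁ ⟶ P₂} {g : P₂ ⟶ P₃} (h : ShortExactSeq f.toLin g.toLin) :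
    Function.Exact (cohomMapRight M f) (cohomMapRight M g) := by
  intro x
  obtain ⟨φ, rfl⟩ := Submodule.Quotient.mk_surjective _ x
  constructor
  · intro hz
    obtain ⟨q, hq⟩ := (Submodule.Quotient.mk_eq_zero _).1 hz
    obtain ⟨σ, hσ⟩ := exists_section h.surjective
    obtain ⟨φ', hφ'⟩ := exists_lift_of_exact h.injective h.exact
      (φ - cohomDiff M P₂ (σ ∘ₗ q)) (by
        rw [LinearMap.comp_sub, cohomDiff_comp_right, ← LinearMap.comp_assoc,
          show g.toLin ∘ₗ σ = LinearMap.id from LinearMap.ext hσ, LinearMap.id_comp, hq, sub_eq_zero]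
        rfl)
    refine ⟨Submodule.Quotient.mk φ', ?_⟩
    change Submodule.Quotient.mk (f.toLin ∘ₗ φ') = _
    rw [hφ', Submodule.Quotient.eq]
    exact ⟨-(σ ∘ₗ q), by rw [map_neg]; abel⟩
  · rintro ⟨y, hy⟩
    obtain ⟨ψ, rfl⟩ := Submodule.Quotient.mk_surjective _ y
    rw [← hy]
    change Submodule.Quotient.mk (g.toLin ∘ₗ f.toLin ∘ₗ ψ) = 0
    rw [← LinearMap.comp_assoc, h.exact.linearMap_comp_eq_zero, LinearMap.zero_comp]
    rfl

theorem cohomMapLeft_surjective {L M : LeftComodule k C} (f : L ⟶ M)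
    (hf : Function.Injective f.toLin) (P : LeftContramodule k C) :
    Function.Surjective (cohomMapLeft f P) := by
  intro x
  obtain ⟨h, rfl⟩ := Submodule.Quotient.mk_surjective _ x
  obtain ⟨ρ, hρ⟩ := exists_retraction hf
  refine ⟨Submodule.Quotient.mk (h ∘ₗ ρ), ?_⟩
  refine congrArg Submodule.Quotient.mk ?_
  ext m
  exact congrArg h (hρ m)

/-- As for the contramodule variable, except that `q` is now extended from `C ⊗ M₁` to `C ⊗ M₂` by a
linear retraction of `f`. -/
theorem cohomMapLeft_exact {M₁ M₂ M₃ : LeftComodule k C} {f : M₁ ⟶ M₂} {g : M₂ ⟶ M₃}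
    (h : ShortExactSeq f.toLin g.toLin) (P : LeftContramodule k C) :
    Function.Exact (cohomMapLeft g P) (cohomMapLeft f P) := by
  intro x
  obtain ⟨φ, rfl⟩ := Submodule.Quotient.mk_surjective _ x
  constructor
  · intro hz
    obtain ⟨q, hq⟩ := (Submodule.Quotient.mk_eq_zero _).1 hz
    obtain ⟨ρ, hρ⟩ := exists_retraction h.injective
    obtain ⟨φ', hφ'⟩ := exists_desc_of_exact h.surjective h.exact
      (φ - cohomDiff M₂ P (q ∘ₗ ρ.lTensor C)) (by
        rw [LinearMap.sub_comp, cohomDiff_comp_left, LinearMap.comp_assoc, ← LinearMap.lTensor_comp,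
          show ρ ∘ₗ f.toLin = LinearMap.id from LinearMap.ext hρ, LinearMap.lTensor_id,
          LinearMap.comp_id, hq, sub_eq_zero]
        rfl)
    refine ⟨Submodule.Quotient.mk φ', ?_⟩
    change Submodule.Quotient.mk (φ' ∘ₗ g.toLin) = _
    rw [hφ', Submodule.Quotient.eq]
    exact ⟨-(q ∘ₗ ρ.lTensor C), by rw [map_neg]; abel⟩
  · rintro ⟨y, hy⟩
    obtain ⟨ψ, rfl⟩ := Submodule.Quotient.mk_surjective _ y
    rw [← hy]
    change Submodule.Quotient.mk ((ψ ∘ₗ g.toLin) ∘ₗ f.toLin) = 0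
    rw [LinearMap.comp_assoc, h.exact.linearMap_comp_eq_zero, LinearMap.comp_zero]
    rfl

theorem contratensorMap_surjective {N₁ N₂ : RightComodule k C} (g : N₁ ⟶ N₂)
    (hg : Function.Surjective g.toLin) (P : LeftContramodule k C) :
    Function.Surjective (contratensorMap g P) := by
  intro x
  obtain ⟨x, rfl⟩ := Submodule.Quotient.mk_surjective _ x
  obtain ⟨y, rfl⟩ := LinearMap.rTensor_surjective P.carrier hg x
  exact ⟨Submodule.Quotient.mk y, rfl⟩

theorem contratensorMap_exact {N₁ N₂ N₃ : RightComodule k C} {f : N₁ ⟶ N₂} {g : N₂ ⟶ N₃}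
    (h : ShortExactSeq f.toLin g.toLin) (P : LeftContramodule k C) :
    Function.Exact (contratensorMap f P) (contratensorMap g P) := by
  have he := rTensor_exact P.carrier h.exact h.surjective
  intro x
  obtain ⟨x, rfl⟩ := Submodule.Quotient.mk_surjective _ x
  constructor
  · intro hz
    obtain ⟨w, hw⟩ := (Submodule.Quotient.mk_eq_zero _).1 hz
    obtain ⟨w, rfl⟩ := LinearMap.rTensor_surjective _ h.surjective w
    have hn := LinearMap.congr_fun (contratensorDiff_naturality g P) w
    simp only [LinearMap.comp_apply] at hn
    obtain ⟨y, hy⟩ := (he (x - contratensorDiff N₂ P w)).1 (by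
      rw [map_sub, ← hn, hw]; exact sub_self _)
    refine ⟨Submodule.Quotient.mk y, ?_⟩
    change Submodule.Quotient.mk (f.toLin.rTensor P.carrier y) = _
    rw [hy, Submodule.Quotient.eq]
    exact ⟨-w, by rw [map_neg]; abel⟩
  · rintro ⟨y, hy⟩
    obtain ⟨y, rfl⟩ := Submodule.Quotient.mk_surjective _ y
    rw [← hy]
    change Submodule.Quotient.mk (g.toLin.rTensor P.carrier (f.toLin.rTensor P.carrier y)) = 0
    rw [he.apply_apply_eq_zero]
    rfl

/-- By right exactness of `Cohom` only injectivity on the left is at stake, here phrased on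
representatives. The next two criteria are of the same kind. -/
theorem Coprojective.of_injective {M : LeftComodule k C}
    (H : ∀ ⦃P Q : LeftContramodule k C⦄ (f : P ⟶ Q), Function.Injective f.toLin →
      ∀ h : M.carrier →ₗ[k] P.carrier, f.toLin ∘ₗ h ∈ LinearMap.range (cohomDiff M Q) →
        h ∈ LinearMap.range (cohomDiff M P)) :
    Coprojective M := fun _ _ _ f g h =>
  { injective := (injective_iff_map_eq_zero _).2 fun x hx => by
      obtain ⟨φ, rfl⟩ := Submodule.Quotient.mk_surjective _ x
      exact (Submodule.Quotient.mk_eq_zero _).2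
        (H f h.injective φ ((Submodule.Quotient.mk_eq_zero _).1 hx))
    exact := cohomMapRight_exact M h
    surjective := cohomMapRight_surjective M g h.surjective }

theorem Coinjective.of_injective {P : LeftContramodule k C}
    (H : ∀ ⦃L M : LeftComodule k C⦄ (g : L ⟶ M), Function.Surjective g.toLin →
      ∀ h : M.carrier →ₗ[k] P.carrier, h ∘ₗ g.toLin ∈ LinearMap.range (cohomDiff L P) →
        h ∈ LinearMap.range (cohomDiff M P)) :
    Coinjective P := fun _ _ _ f g h =>
  { injective := (injective_iff_map_eq_zero _).2 fun x hx => by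
      obtain ⟨φ, rfl⟩ := Submodule.Quotient.mk_surjective _ x
      exact (Submodule.Quotient.mk_eq_zero _).2
        (H g h.surjective φ ((Submodule.Quotient.mk_eq_zero _).1 hx))
    exact := cohomMapLeft_exact h P
    surjective := cohomMapLeft_surjective f h.injective P }

theorem Contraflat.of_injective {P : LeftContramodule k C}
    (H : ∀ ⦃N N' : RightComodule k C⦄ (f : N ⟶ N'), Function.Injective f.toLin →
      ∀ x, f.toLin.rTensor P.carrier x ∈ LinearMap.range (contratensorDiff N' P) →
        x ∈ LinearMap.range (contratensorDiff N P)) :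
    Contraflat P := fun _ _ _ f g h =>
  { injective := (injective_iff_map_eq_zero _).2 fun x hx => by
      obtain ⟨φ, rfl⟩ := Submodule.Quotient.mk_surjective _ x
      exact (Submodule.Quotient.mk_eq_zero _).2
        (H f h.injective φ ((Submodule.Quotient.mk_eq_zero _).1 hx))
    exact := contratensorMap_exact h P
    surjective := contratensorMap_surjective g h.surjective P }

/-! ### Split comodules are coprojective -/

/-- The coaction of `M` has a colinear retraction. -/
def LeftComodule.IsSplit (M : LeftComodule k C) : Prop :=
  ∃ r : C ⊗[k] M.carrier →ₗ[k] M.carrier, (∀ m, r (M.coact m) = m) ∧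
    ∀ c m, M.coact (r (c ⊗ₜ m)) =
      r.lTensor C (TensorProduct.assoc k C C M.carrier (Coalgebra.comul (R := k) c ⊗ₜ m))

/-- Let `T h` send `m` to `π (c ↦ h (r (c ⊗ m)))`. Contraassociativity and colinearity of `r` show
that `T` kills the range of `cohomDiff` (`key`), while `h - T h = cohomDiff (h ∘ r)` because `r ∘ ν
= id`. So that range is `ker T`. As `T` is natural in `P`, an injective `f` reflects membership. -/
theorem LeftComodule.IsSplit.coprojective {M : LeftComodule k C} (hM : M.IsSplit) :
    Coprojective M := by
  obtain ⟨r, hr, hc⟩ := hM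
  have key : ∀ (P : LeftContramodule k C) (g : C ⊗[k] M.carrier →ₗ[k] P.carrier) (m : M.carrier),
      P.contract ((TensorProduct.curry (cohomDiff M P g ∘ₗ r)).flip m) = 0 := by
    intro P g m
    let F : C →ₗ[k] C →ₗ[k] P.carrier :=
      (TensorProduct.curry g).flip ∘ₗ (TensorProduct.curry r).flip m
    have e : (TensorProduct.curry (cohomDiff M P g ∘ₗ r)).flip m =
        TensorProduct.lift F.flip ∘ₗ Coalgebra.comul - P.contract ∘ₗ F := by
      ext c
      simp only [LinearMap.flip_apply, TensorProduct.curry_apply, LinearMap.comp_apply,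
        cohomDiff_apply, LinearMap.sub_apply, hc]
      congr 1
      generalize Coalgebra.comul (R := k) c = x
      induction x with
      | zero => simp
      | add x y hx hy => simp only [map_add, TensorProduct.add_tmul, hx, hy]
      | tmul a b => simp [F]
    rw [e, map_sub, P.contraassoc, sub_self]
  refine Coprojective.of_injective fun P Q f hf h ⟨g, hg⟩ => ⟨h ∘ₗ r, ?_⟩
  ext m
  rw [cohomDiff_apply, LinearMap.comp_apply, hr]
  have h0 : P.contract ((TensorProduct.curry (h ∘ₗ r)).flip m) = 0 := by
    apply hf
    rw [map_zero, f.comm, ← key Q g m, hg]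
    rfl
  rw [h0, sub_zero]

/-! ### Coprojective comodules are coflat -/

/-- The contramodule `Hom(N, V)`. -/
noncomputable def RightComodule.homContra (N : RightComodule k C) (V : Type u) [AddCommGroup V]
    [Module k V] : LeftContramodule k C where
  carrier := N.carrier →ₗ[k] V
  contract :=
    { toFun := fun F => TensorProduct.lift F.flip ∘ₗ N.coact
      map_add' := fun F G => by
        rw [← LinearMap.add_comp]
        congr 1
        ext
        simp
      map_smul' := fun a F => by
        rw [RingHom.id_apply, ← LinearMap.smul_comp]
        congr 1
        ext
        simp }
  contraassoc := fun F => by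
    refine LinearMap.ext fun n => ?_
    have h := LinearMap.congr_fun N.coassoc n
    simp only [LinearMap.comp_apply, LinearEquiv.coe_coe] at h
    simp only [LinearMap.coe_mk, AddHom.coe_mk, LinearMap.comp_apply]
    let Φ : N.carrier ⊗[k] (C ⊗[k] C) →ₗ[k] V :=
      TensorProduct.lift (TensorProduct.lift F.flip).flip
    trans Φ ((Coalgebra.comul (R := k) (A := C)).lTensor _ (N.coact n))
    · generalize N.coact n = x
      induction x with
      | zero => simp
      | add x y hx hy => simp only [map_add, hx, hy]
      | tmul n c => simp [Φ]
    · rw [← h]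
      generalize N.coact n = x
      induction x with
      | zero => simp
      | add x y hx hy => simp only [map_add, hx, hy]
      | tmul n c =>
        simp only [LinearMap.rTensor_tmul, TensorProduct.lift.tmul, LinearMap.flip_apply,
          LinearMap.comp_apply, LinearMap.coe_mk, AddHom.coe_mk]
        generalize N.coact n = x
        induction x with
        | zero => simp
        | add x y hx hy => simp only [map_add, TensorProduct.add_tmul, hx, hy]
        | tmul n d => simp [Φ]
  contraunit := fun p => by
    refine LinearMap.ext fun n => ?_
    have h := LinearMap.congr_fun N.counit_coact n
    simp only [LinearMap.comp_apply] at h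
    have h' : ∀ x, TensorProduct.lift ((Coalgebra.counit (R := k) (A := C)).smulRight p).flip x =
        p (TensorProduct.rid k _ ((Coalgebra.counit (R := k) (A := C)).lTensor _ x)) := by
      intro x
      induction x with
      | zero => simp
      | add x y hx hy => simp only [map_add, hx, hy]
      | tmul n c => simp
    simp only [LinearMap.coe_mk, AddHom.coe_mk, LinearMap.comp_apply]
    rw [h', h]
    simp

/-- Precomposition with a comodule morphism as a contramodule morphism. -/
noncomputable def RightComodule.homContraMap {N N' : RightComodule k C} (f : N ⟶ N')
    (V : Type u) [AddCommGroup V] [Module k V] : N'.homContra V ⟶ N.homContra V :=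
  LeftContramodule.Hom.mk (LinearMap.lcomp k V f.toLin) fun F => by
    refine LinearMap.ext fun n => ?_
    change TensorProduct.lift F.flip (N'.coact (f.toLin n)) =
      TensorProduct.lift (LinearMap.lcomp k V f.toLin ∘ₗ F).flip (N.coact n)
    have h := LinearMap.congr_fun f.comm n
    simp only [LinearMap.comp_apply] at h
    rw [h]
    generalize N.coact n = x
    induction x with
    | zero => simp
    | add x y hx hy => simp only [map_add, hx, hy]
    | tmul n c => simp only [LinearMap.rTensor_tmul, TensorProduct.lift.tmul]; rfl

/-- For the contramodule `N^*`, the map `cohomDiff` is minus the transpose of `cotensorDiff`. -/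
theorem lift_cohomDiff_homContra (M : LeftComodule k C) (N : RightComodule k C)
    (g : C ⊗[k] M.carrier →ₗ[k] N.carrier →ₗ[k] k) (x : N.carrier ⊗[k] M.carrier) :
    TensorProduct.lift (LinearMap.flip (cohomDiff M (N.homContra k) g)) x =
      - TensorProduct.lift g.flip (cotensorDiff N M x) := by
  induction x with
  | zero => simp
  | add x y hx hy => simp only [map_add, hx, hy, neg_add]
  | tmul n m =>
    rw [cotensorDiff_tmul, map_sub, neg_sub, TensorProduct.lift.tmul, TensorProduct.lift.tmul]
    change g (M.coact m) n - TensorProduct.lift (LinearMap.flip ((TensorProduct.curry g).flip m))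
      (N.coact n) = _
    congr 1
    generalize N.coact n = x
    induction x with
    | zero => simp
    | add x y hx hy => simp only [map_add, TensorProduct.add_tmul, hx, hy]
    | tmul n d => simp

/-- This is `Cohom_C(M, N^*) = (N □ M)^*`: the image of a transpose is the annihilator of the
kernel. -/
theorem mem_range_cohomDiff_homContra_iff (M : LeftComodule k C) (N : RightComodule k C)
    (h : M.carrier →ₗ[k] N.carrier →ₗ[k] k) :
    h ∈ LinearMap.range (cohomDiff M (N.homContra k)) ↔
      ∀ x ∈ cotensor N M, TensorProduct.lift h.flip x = 0 := by
  constructor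
  · rintro ⟨g, rfl⟩ x hx
    rw [cotensor, LinearMap.mem_ker] at hx
    refine (lift_cohomDiff_homContra M N g x).trans ?_
    rw [hx, map_zero, neg_zero]
  · intro H
    obtain ⟨Ψ, hΨ⟩ := exists_factor_of_ker_le (h := TensorProduct.lift h.flip)
      (d := cotensorDiff N M) H
    refine ⟨-(TensorProduct.curry Ψ).flip, ?_⟩
    have e : TensorProduct.lift (LinearMap.flip (cohomDiff M (N.homContra k)
        (-(TensorProduct.curry Ψ).flip))) = TensorProduct.lift h.flip := by
      ext n m
      refine (lift_cohomDiff_homContra M N _ (n ⊗ₜ m)).trans ?_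
      rw [← hΨ]
      change _ = Ψ (cotensorDiff N M (n ⊗ₜ m))
      generalize cotensorDiff N M (n ⊗ₜ m) = y
      induction y with
      | zero => simp
      | add x y hx hy => simp only [map_add, neg_add, hx, hy]
      | tmul n y => simp
    have e' := TensorProduct.lift.equiv (RingHom.id k) N.carrier M.carrier k |>.injective e
    exact congrArg LinearMap.flip e'

/-- Dualizing the sequence gives a short exact sequence of contramodules, so `(N₃ □ M)^* → (N₂ □
M)^*` is injective, whence `N₂ □ M → N₃ □ M` is surjective. -/
theorem Coprojective.coflat {M : LeftComodule k C} (hM : Coprojective M) : Coflat M := by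
  intro N₁ N₂ N₃ f g hs
  refine ⟨cotensorMap_injective f hs.injective M, cotensorMap_exact hs M, ?_⟩
  have hd : ShortExactSeq (RightComodule.homContraMap g k).toLin
      (RightComodule.homContraMap f k).toLin := by
    refine ⟨fun a b hab => ?_, fun φ => ⟨fun hφ => ?_, ?_⟩, fun φ => ?_⟩
    · exact (LinearMap.cancel_right hs.surjective).1 hab
    · exact exists_desc_of_exact hs.surjective hs.exact φ hφ
    · rintro ⟨ψ, rfl⟩
      refine LinearMap.ext fun x => ?_
      exact (congrArg (show N₃.carrier →ₗ[k] k from ψ) (hs.exact.apply_apply_eq_zero x)).trans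
        (map_zero _)
    · obtain ⟨ρ, hρ⟩ := exists_retraction hs.injective
      refine ⟨(φ ∘ₗ ρ : N₂.carrier →ₗ[k] k), LinearMap.ext fun x => ?_⟩
      exact congrArg (show N₁.carrier →ₗ[k] k from φ) (hρ x)
  have hi := (hM _ _ hd).injective
  rintro ⟨z, hz⟩
  by_contra hcon
  have hzR : z ∉ (cotensor N₂ M).map (g.toLin.rTensor M.carrier) := by
    rintro ⟨y, hy, e⟩
    exact hcon ⟨⟨y, hy⟩, Subtype.ext e⟩
  -- A functional on `N₃ ⊗ M` that vanishes on the image of `N₂ □ M` but not at `z`. Its class in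
  -- `Cohom_C(M, N₃^*)` goes to zero for `N₂`, hence is zero, contradicting its value at `z`.
  obtain ⟨ℓ, hℓz, hℓ⟩ := Submodule.exists_le_ker_of_notMem hzR
  let h : M.carrier →ₗ[k] N₃.carrier →ₗ[k] k := (TensorProduct.curry ℓ).flip
  have e1 : ∀ x, TensorProduct.lift h.flip x = ℓ x := by
    intro x
    induction x with
    | zero => simp
    | add x y hx hy => simp only [map_add, hx, hy]
    | tmul n y => simp [h]
  have hmem : h ∈ LinearMap.range (cohomDiff M (N₃.homContra k)) := by
    refine (Submodule.Quotient.mk_eq_zero (LinearMap.range (cohomDiff M (N₃.homContra k)))).1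
      (hi (Eq.trans ?_ (map_zero (cohomMapRight M _)).symm))
    refine (Submodule.Quotient.mk_eq_zero _).2
      ((mem_range_cohomDiff_homContra_iff M N₂ (LinearMap.lcomp k k g.toLin ∘ₗ h)).2 ?_)
    intro x hx
    have e2 : ∀ x, TensorProduct.lift (LinearMap.lcomp k k g.toLin ∘ₗ h).flip x =
        ℓ (g.toLin.rTensor M.carrier x) := by
      intro x
      induction x with
      | zero => simp
      | add x y hx hy => simp only [map_add, hx, hy]
      | tmul n y => simp [h]
    rw [e2]
    exact hℓ ⟨x, hx, rfl⟩
  exact hℓz ((e1 z).symm.trans ((mem_range_cohomDiff_homContra_iff M N₃ h).1 hmem z hz))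

end Contra

namespace Contra

variable {k C : Type u} [Field k] [AddCommGroup C] [Module k C] [Coalgebra k C]

/-! ### Injective comodules are split -/

namespace LeftComodule

/-- The cofree left comodule `C ⊗ V`. -/
noncomputable def cofree (V : Type u) [AddCommGroup V] [Module k V] : LeftComodule k C where
  carrier := C ⊗[k] V
  coact := (TensorProduct.assoc k C C V).toLinearMap ∘ₗ
    (Coalgebra.comul (R := k) (A := C)).rTensor V
  coassoc := by
    refine TensorProduct.ext' fun c v => ?_
    have h := Coalgebra.coassoc_apply (R := k) c
    let Ψ : C ⊗[k] (C ⊗[k] C) →ₗ[k] C ⊗[k] (C ⊗[k] (C ⊗[k] V)) :=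
      (((TensorProduct.mk k C V).flip v).lTensor C).lTensor C
    simp only [LinearMap.comp_apply, LinearEquiv.coe_coe, LinearMap.rTensor_tmul]
    trans Ψ (TensorProduct.assoc k C C C
      ((Coalgebra.comul (R := k) (A := C)).rTensor C (Coalgebra.comul (R := k) c)))
    · generalize Coalgebra.comul (R := k) c = x
      induction x with
      | zero => simp
      | add x y hx hy => simp only [map_add, TensorProduct.add_tmul, hx, hy]
      | tmul a b =>
        simp only [LinearMap.rTensor_tmul, TensorProduct.assoc_tmul]
        generalize Coalgebra.comul (R := k) a = x
        induction x with
        | zero => simp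
        | add x y hx hy => simp only [map_add, TensorProduct.add_tmul, hx, hy]
        | tmul c d => simp [Ψ]
    · rw [h]
      generalize Coalgebra.comul (R := k) c = x
      induction x with
      | zero => simp
      | add x y hx hy => simp only [map_add, TensorProduct.add_tmul, hx, hy]
      | tmul a b =>
        simp only [LinearMap.lTensor_tmul, TensorProduct.assoc_tmul, LinearMap.comp_apply,
          LinearEquiv.coe_coe, LinearMap.rTensor_tmul]
        generalize Coalgebra.comul (R := k) b = x
        induction x with
        | zero => simp
        | add x y hx hy =>
          simp only [map_add, TensorProduct.add_tmul, TensorProduct.tmul_add, hx, hy]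
        | tmul c d => simp [Ψ]
  counit_coact := by
    refine TensorProduct.ext' fun c v => ?_
    have h := Coalgebra.rTensor_counit_comul (R := k) c
    simp only [LinearMap.comp_apply, LinearEquiv.coe_coe, LinearMap.rTensor_tmul]
    have h' : ∀ x : C ⊗[k] C, (Coalgebra.counit (R := k) (A := C)).rTensor (C ⊗[k] V)
        (TensorProduct.assoc k C C V (x ⊗ₜ v)) =
        ((TensorProduct.mk k C V).flip v).lTensor k
          ((Coalgebra.counit (R := k) (A := C)).rTensor C x) := by
      intro x
      induction x with
      | zero => simp
      | add x y hx hy => simp only [map_add, TensorProduct.add_tmul, hx, hy]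
      | tmul a b => simp
    rw [h', h]
    simp

/-- The coaction is a monomorphism into the cofree comodule `C ⊗ M`, so the identity of `M` extends
along it. -/
theorem isSplit_of_injective (M : LeftComodule k C) [Injective M] : M.IsSplit := by
  let ν : M ⟶ cofree M.carrier := LeftComodule.Hom.mk M.coact <| by
    ext m
    exact LinearMap.congr_fun M.coassoc m
  have hν : Function.Injective ν.toLin := by
    intro x y h
    rw [← M.act_counit x, ← M.act_counit y]
    exact congrArg (sliceLeft M.carrier Coalgebra.counit) h
  have : Mono ν := mono_of_injective ν hν
  let r : cofree M.carrier ⟶ M := Injective.factorThru (𝟙 M) ν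
  refine ⟨r.toLin, fun m => ?_, fun c m => LinearMap.congr_fun r.comm (c ⊗ₜ m)⟩
  exact LinearMap.congr_fun
    (congrArg LeftComodule.Hom.toLin (Injective.comp_factorThru (𝟙 M) ν)) m

end LeftComodule

/-! ### Coflat comodules are injective -/

theorem pairHom_dualMap {L M : LeftComodule k C} [Module.Finite k L.carrier]
    [Module.Finite k M.carrier] (i : L ⟶ M) {V : Type u} [AddCommGroup V] [Module k V]
    (x : Module.Dual k M.carrier ⊗[k] V) :
    pairHom (M := L) (N := L.dual) (LinearEquiv.refl k (Module.Dual k L.carrier)) V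
        ((LeftComodule.dualMap i).toLin.rTensor V x) =
      pairHom (M := M) (N := M.dual) (LinearEquiv.refl k (Module.Dual k M.carrier)) V x ∘ₗ
        i.toLin := by
  have h : pairHom (M := L) (N := L.dual) (LinearEquiv.refl k (Module.Dual k L.carrier)) V ∘ₗ
      (LeftComodule.dualMap i).toLin.rTensor V = LinearMap.lcomp k V i.toLin ∘ₗ
        pairHom (M := M) (N := M.dual) (LinearEquiv.refl k (Module.Dual k M.carrier)) V :=
    TensorProduct.ext' fun φ v => rfl
  exact LinearMap.congr_fun h x

/-- The transpose of `i` is surjective, so by coflatness `L'^* □ M → L^* □ M` is too; under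
`mem_cotensor_iff` this is restriction of colinear maps along `i`. -/
theorem Coflat.exists_extension_of_finite {M : LeftComodule k C} (hM : Coflat M)
    {L L' : LeftComodule k C} [Module.Finite k L.carrier] [Module.Finite k L'.carrier]
    (i : L ⟶ L') (hi : Function.Injective i.toLin) (g : L ⟶ M) :
    ∃ h : L' ⟶ M, ∀ x, h.toLin (i.toLin x) = g.toLin x := by
  obtain ⟨z, hz⟩ := (pairHom_bijective (M := L) (N := L.dual)
    (LinearEquiv.refl k (Module.Dual k L.carrier)) (V := M.carrier)).2 g.toLin
  have hsurj : Function.Surjective (LeftComodule.dualMap i).toLin :=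
    LinearMap.dualMap_surjective_of_injective hi
  obtain ⟨y, hy, e⟩ := hM.exists_preimage (LeftComodule.dualMap i) hsurj z
    ((mem_cotensor_iff L.dual_coactCompatible M z).2 (by rw [hz]; exact g.comm))
  refine ⟨LeftComodule.Hom.mk (pairHom (M := L') (N := L'.dual)
    (LinearEquiv.refl k (Module.Dual k L'.carrier)) M.carrier y)
    ((mem_cotensor_iff L'.dual_coactCompatible M y).1 hy), fun x => ?_⟩
  rw [← hz, ← e]
  exact (LinearMap.congr_fun (pairHom_dualMap i y) x).symm

/-- The domain of a partially defined linear map is a subcomodule on which the map is colinear. -/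
def IsPartialColinear {X M : LeftComodule k C} (p : X.carrier →ₗ.[k] M.carrier) : Prop :=
  ∀ γ (x : p.domain), ∃ h : X.act γ x ∈ p.domain, p ⟨X.act γ x, h⟩ = M.act γ (p x)

/-- Take a finite-dimensional subcomodule `F` containing `x`, extend `p` from `F ⊓ p.domain` to `F`
by the finite-dimensional case, and glue on the sum of `p.domain` and `F`. -/
theorem IsPartialColinear.exists_extension {X M : LeftComodule k C} (hM : Coflat M)
    {p : X.carrier →ₗ.[k] M.carrier} (hp : IsPartialColinear p) (x : X.carrier) :
    ∃ q, IsPartialColinear q ∧ p ≤ q ∧ x ∈ q.domain := by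
  obtain ⟨F, hxF, hF, hFa⟩ := X.exists_finite_sub (Submodule.span k {x}) inferInstance
  have hxF : x ∈ F := hxF (Submodule.mem_span_singleton_self x)
  have hGa : ∀ γ, ∀ m ∈ F ⊓ p.domain, X.act γ m ∈ F ⊓ p.domain := fun γ m hm =>
    ⟨hFa γ m hm.1, (hp γ ⟨m, hm.2⟩).1⟩
  let F' := X.sub F hFa
  let G' := X.sub (F ⊓ p.domain) hGa
  have : Module.Finite k F'.carrier := hF
  have : Module.Finite k G'.carrier :=
    Submodule.finiteDimensional_of_le (inf_le_left : F ⊓ p.domain ≤ F)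
  have actF : ∀ γ (y : F), F.subtype (F'.act γ y) = X.act γ y := fun γ y =>
    LeftComodule.hom_act (X.incl F hFa) γ y
  have actG : ∀ γ (y : (F ⊓ p.domain : Submodule k X.carrier)),
      (F ⊓ p.domain).subtype (G'.act γ y) = X.act γ y := fun γ y =>
    LeftComodule.hom_act (X.incl _ hGa) γ y
  let i : G' ⟶ F' := LeftComodule.homOfAct (Submodule.inclusion inf_le_left) fun γ y =>
    F.subtype_injective (Eq.trans (b := X.act γ ((F ⊓ p.domain).subtype y))
      (actG γ y) (actF γ (Submodule.inclusion inf_le_left y)).symm)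
  let g : G' ⟶ M := LeftComodule.homOfAct (p.toFun ∘ₗ Submodule.inclusion inf_le_right) fun γ y => by
    obtain ⟨h, e⟩ := hp γ ⟨y.1, y.2.2⟩
    refine Eq.trans (congrArg p.toFun ?_) e
    exact p.domain.subtype_injective (actG γ y)
  obtain ⟨h, hh⟩ := hM.exists_extension_of_finite i (Submodule.inclusion_injective (inf_le_left : F ⊓ p.domain ≤ F)) g
  let h' : F →ₗ[k] M.carrier := h.toLin
  have hag : ∀ (a : p.domain) (b : (LinearPMap.mk F h').domain), (a : X.carrier) = b →
      p a = LinearPMap.mk F h' b := by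
    rintro ⟨a, ha⟩ ⟨b, hb⟩ rfl
    exact (hh ⟨a, hb, ha⟩).symm
  refine ⟨p.sup ⟨F, h'⟩ hag, ?_, p.left_le_sup _ hag, Submodule.mem_sup_right hxF⟩
  rintro γ ⟨z, hz⟩
  obtain ⟨a, ha, b, hb, rfl⟩ := Submodule.mem_sup.1 hz
  obtain ⟨ha', ea⟩ := hp γ ⟨a, ha⟩
  have e : X.act γ a + X.act γ b = X.act γ (a + b) := (map_add _ _ _).symm
  have hm : X.act γ (a + b) ∈ p.domain ⊔ F := e ▸ Submodule.add_mem_sup ha' (hFa γ b hb)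
  have e₁ := LinearPMap.sup_apply hag ⟨X.act γ a, ha'⟩ ⟨X.act γ b, hFa γ b hb⟩
    ⟨X.act γ (a + b), hm⟩ e
  have e₂ := LinearPMap.sup_apply hag ⟨a, ha⟩ ⟨b, hb⟩ ⟨a + b, hz⟩ rfl
  refine ⟨hm, e₁.trans (Eq.trans ?_ (congrArg (M.act γ) e₂).symm)⟩
  rw [map_add, ea]
  refine congrArg _ (Eq.trans ?_ (LeftComodule.hom_act h γ ⟨b, hb⟩))
  exact congrArg h.toLin (Subtype.ext (actF γ ⟨b, hb⟩).symm)

/-- A maximal partial colinear extension of `g ∘ f⁻¹`, defined on the range of `f`, exists by Zorn's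
lemma. It is everywhere defined, since it could otherwise be extended by one more vector. -/
theorem Coflat.injective {M : LeftComodule k C} (hM : Coflat M) : Injective M where
  factors {X Y} g f _ := by
    have hf := LeftComodule.injective_of_mono f
    let e := LinearEquiv.ofInjective f.toLin hf
    let p₀ : Y.carrier →ₗ.[k] M.carrier := ⟨LinearMap.range f.toLin, g.toLin ∘ₗ e.symm⟩
    have hp₀ : ∀ (x) (h : f.toLin x ∈ p₀.domain), p₀ ⟨f.toLin x, h⟩ = g.toLin x := fun x h =>
      congrArg g.toLin (e.symm_apply_apply x)
    have h₀ : IsPartialColinear p₀ := by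
      rintro γ ⟨_, x, rfl⟩
      refine ⟨⟨X.act γ x, LeftComodule.hom_act f γ x⟩, ?_⟩
      have e₁ := (hp₀ (X.act γ x) ⟨_, rfl⟩).trans (LeftComodule.hom_act g γ x)
      refine Eq.trans ?_ (e₁.trans (congrArg (M.act γ) (hp₀ x ⟨x, rfl⟩).symm))
      exact congrArg p₀.toFun (Subtype.ext (LeftComodule.hom_act f γ x).symm)
    obtain ⟨p, hle, hp⟩ := zorn_le_nonempty₀ {p : Y.carrier →ₗ.[k] M.carrier | IsPartialColinear p}
      (fun c hc hchain y hy => by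
        have hd : DirectedOn (· ≤ ·) c := hchain.directedOn
        refine ⟨LinearPMap.sSup c hd, ?_, fun z hz => LinearPMap.le_sSup hd hz⟩
        rintro γ ⟨x, hx⟩
        obtain ⟨q, hq, hxq⟩ := (LinearPMap.mem_domain_sSup_iff ⟨y, hy⟩ hd).1 hx
        obtain ⟨h, e⟩ := hc hq γ ⟨x, hxq⟩
        have hl := LinearPMap.le_sSup hd hq
        refine ⟨hl.1 h, ?_⟩
        rw [← hl.2 (x := ⟨x, hxq⟩) (y := ⟨x, hx⟩) rfl, ← e]
        exact (hl.2 rfl).symm) p₀ h₀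
    have htop : ∀ y, y ∈ p.domain := fun y => by
      obtain ⟨q, hq, hpq, hy⟩ := IsPartialColinear.exists_extension hM hp.1 y
      exact (hp.2 hq hpq).1 hy
    let h : Y ⟶ M := LeftComodule.homOfAct
      (p.toFun ∘ₗ LinearMap.codRestrict p.domain LinearMap.id htop) fun γ y =>
        (hp.1 γ ⟨y, htop y⟩).2
    refine ⟨h, LeftComodule.Hom.ext (LinearMap.ext fun x => ?_)⟩
    exact (hle.2 (x := ⟨f.toLin x, x, rfl⟩) (y := ⟨f.toLin x, htop _⟩) rfl).symm.trans
      (hp₀ x ⟨x, rfl⟩)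

end Contra

namespace Contra

variable {k C : Type u} [Field k] [AddCommGroup C] [Module k C] [Coalgebra k C]

/-! ### Quotient contramodules -/

namespace LeftContramodule

/-- The quotient of a contramodule by a subcontramodule. -/
noncomputable def quot (P : LeftContramodule k C) (S : Submodule k P.carrier)
    (hS : ∀ f : C →ₗ[k] P.carrier, (∀ c, f c ∈ S) → P.contract f ∈ S) : LeftContramodule k C :=
  let σ := (exists_section S.mkQ_surjective).choose
  have hσ : ∀ x, S.mkQ (σ x) = x := (exists_section S.mkQ_surjective).choose_spec
  -- The choice of section is immaterial: `σ ∘ S.mkQ ∘ f` and `f` differ by a map with values in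
  -- `S`, which contracts into `S`.
  have hq : ∀ f : C →ₗ[k] P.carrier,
      S.mkQ (P.contract (σ ∘ₗ S.mkQ ∘ₗ f)) = S.mkQ (P.contract f) := fun f => by
    rw [← sub_eq_zero, ← map_sub, ← map_sub, ← LinearMap.mem_ker, Submodule.ker_mkQ]
    refine hS _ fun c => ?_
    refine (Submodule.Quotient.mk_eq_zero S).1 ?_
    change S.mkQ _ = 0
    simp only [LinearMap.sub_apply, LinearMap.comp_apply, map_sub, hσ, sub_self]
  { carrier := P.carrier ⧸ S
    contract := S.mkQ ∘ₗ P.contract ∘ₗ σ.compRight k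
    contraassoc := fun F => by
      have h := P.contraassoc (σ.compRight k ∘ₗ F)
      have e : TensorProduct.lift (σ.compRight k ∘ₗ F).flip = σ ∘ₗ TensorProduct.lift F.flip := by
        ext
        simp
      rw [e] at h
      simp only [LinearMap.comp_apply, LinearMap.compRight_apply, ← LinearMap.comp_assoc, h]
      rw [← hq]
      rfl
    contraunit := fun p => by
      have e : σ ∘ₗ (Coalgebra.counit (R := k) (A := C)).smulRight p =
          (Coalgebra.counit (R := k) (A := C)).smulRight (σ p) := by
        ext
        simp
      simp only [LinearMap.comp_apply, LinearMap.compRight_apply, e, P.contraunit, hσ] }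

/-- The projection to a quotient contramodule. -/
noncomputable def quotMk (P : LeftContramodule k C) (S : Submodule k P.carrier)
    (hS : ∀ f : C →ₗ[k] P.carrier, (∀ c, f c ∈ S) → P.contract f ∈ S) : P ⟶ P.quot S hS :=
  LeftContramodule.Hom.mk S.mkQ fun f => by
    let σ := (exists_section S.mkQ_surjective).choose
    have hσ : ∀ x, S.mkQ (σ x) = x := (exists_section S.mkQ_surjective).choose_spec
    change S.mkQ (P.contract f) = S.mkQ (P.contract (σ ∘ₗ S.mkQ ∘ₗ f))
    rw [← sub_eq_zero, ← map_sub, ← map_sub, ← LinearMap.mem_ker, Submodule.ker_mkQ]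
    refine hS _ fun c => ?_
    refine (Submodule.Quotient.mk_eq_zero S).1 ?_
    change S.mkQ _ = 0
    simp only [LinearMap.sub_apply, LinearMap.comp_apply, map_sub, hσ, sub_self]

/-- Over a field `g` lifts linearly to a map `C → P`, and `f` commutes with contraactions. -/
theorem contract_mem_range {P Q : LeftContramodule k C} (f : P ⟶ Q) (g : C →ₗ[k] Q.carrier)
    (hg : ∀ c, g c ∈ LinearMap.range f.toLin) : Q.contract g ∈ LinearMap.range f.toLin := by
  obtain ⟨σ, hσ⟩ := exists_section f.toLin.surjective_rangeRestrict
  refine ⟨P.contract (σ ∘ₗ g.codRestrict _ hg), ?_⟩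
  rw [f.comm]
  congr 1
  ext c
  exact congrArg Subtype.val (hσ ⟨g c, hg c⟩)

theorem surjective_of_epi {P Q : LeftContramodule k C} (f : P ⟶ Q) [Epi f] :
    Function.Surjective f.toLin := by
  let K := Q.quot (LinearMap.range f.toLin) (contract_mem_range f)
  let z : Q ⟶ K := LeftContramodule.Hom.mk 0 fun g =>
    ((congrArg K.contract (LinearMap.zero_comp g)).trans (map_zero _)).symm
  have h : Q.quotMk (LinearMap.range f.toLin) (contract_mem_range f) = z := by
    rw [← cancel_epi f]
    apply LeftContramodule.Hom.ext
    ext x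
    exact (Submodule.Quotient.mk_eq_zero _).2 ⟨x, rfl⟩
  intro y
  exact (Submodule.Quotient.mk_eq_zero _).1
    (LinearMap.congr_fun (congrArg LeftContramodule.Hom.toLin h) y)

theorem epi_of_surjective {P Q : LeftContramodule k C} (f : P ⟶ Q)
    (hf : Function.Surjective f.toLin) : Epi f where
  left_cancellation g h e := by
    apply LeftContramodule.Hom.ext
    rw [← LinearMap.cancel_right hf]
    exact congrArg LeftContramodule.Hom.toLin e

/-- The contraaction of `P` has a contramodule section `P → Hom(C, P)`. -/
def IsSplit (P : LeftContramodule k C) : Prop :=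
  ∃ s : P.carrier →ₗ[k] C →ₗ[k] P.carrier, (∀ p, P.contract (s p) = p) ∧
    ∀ f : C →ₗ[k] P.carrier,
      s (P.contract f) = TensorProduct.lift (s ∘ₗ f).flip ∘ₗ Coalgebra.comul

end LeftContramodule

/-- The coalgebra as a right comodule over itself. -/
noncomputable def RightComodule.regular (k C : Type u) [Field k] [AddCommGroup C] [Module k C]
    [Coalgebra k C] : RightComodule k C where
  carrier := C
  coact := Coalgebra.comul
  coassoc := Coalgebra.coassoc
  counit_coact := Coalgebra.lTensor_counit_comp_comul

/-- The coalgebra as a left comodule over itself. -/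
noncomputable def LeftComodule.regular (k C : Type u) [Field k] [AddCommGroup C] [Module k C]
    [Coalgebra k C] : LeftComodule k C where
  carrier := C
  coact := Coalgebra.comul
  coassoc := Coalgebra.coassoc
  counit_coact := Coalgebra.rTensor_counit_comp_comul

/-! ### Projective contramodules are split, and split ones are projective and coinjective -/

namespace LeftContramodule

/-- Contraassociativity makes `π` a morphism from the free contramodule `Hom(C, P)`, and the unit
axiom makes it surjective. -/
theorem isSplit_of_projective (P : LeftContramodule k C) [Projective P] : P.IsSplit := by
  let π : (RightComodule.regular k C).homContra P.carrier ⟶ P :=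
    LeftContramodule.Hom.mk P.contract P.contraassoc
  have : Epi π := epi_of_surjective π fun p => ⟨_, P.contraunit p⟩
  let s : P ⟶ (RightComodule.regular k C).homContra P.carrier := Projective.factorThru (𝟙 P) π
  refine ⟨s.toLin, fun p => ?_, fun f => s.comm f⟩
  exact LinearMap.congr_fun
    (congrArg LeftContramodule.Hom.toLin (Projective.factorThru_comp (𝟙 P) π)) p

/-- Lift `h` linearly to `σ ∘ h` and average: `p ↦ π (σ ∘ h ∘ s p)` is a contramodule map, and it
still lifts `h` because `π ∘ s = id`. -/
theorem IsSplit.projective {P : LeftContramodule k C} (hP : P.IsSplit) : Projective P where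
  factors {Y X} h e _ := by
    obtain ⟨s, hs, hc⟩ := hP
    obtain ⟨σ, hσ⟩ := exists_section (surjective_of_epi e)
    let φ : P.carrier →ₗ[k] Y.carrier := Y.contract ∘ₗ (σ ∘ₗ h.toLin).compRight k ∘ₗ s
    refine ⟨LeftContramodule.Hom.mk φ fun f => ?_, LeftContramodule.Hom.ext ?_⟩
    · have e₁ : (σ ∘ₗ h.toLin) ∘ₗ TensorProduct.lift (s ∘ₗ f).flip =
          TensorProduct.lift ((σ ∘ₗ h.toLin).compRight k ∘ₗ s ∘ₗ f).flip := by
        ext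
        simp
      change Y.contract ((σ ∘ₗ h.toLin) ∘ₗ s (P.contract f)) = _
      rw [hc, ← LinearMap.comp_assoc, e₁, Y.contraassoc]
      rfl
    · ext p
      change e.toLin (Y.contract (_ ∘ₗ s p)) = h.toLin p
      rw [e.comm, ← LinearMap.comp_assoc, ← LinearMap.comp_assoc,
        show e.toLin ∘ₗ σ = LinearMap.id from LinearMap.ext hσ, LinearMap.id_comp, ← h.comm, hs]

/-- Let `T h` be the coaction of `M` followed by `c ⊗ m ↦ s (h m) c`. Coassociativity and the
morphism property of `s` show that `T` kills the range of `cohomDiff` (`key`). Since `π ∘ s = id`,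
`h - T h` is the image of minus the map `c ⊗ m ↦ s (h m) c`. So the range is `ker T`, and naturality
in `M` lets a surjective `g` be cancelled. -/
theorem IsSplit.coinjective {P : LeftContramodule k C} (hP : P.IsSplit) : Coinjective P := by
  obtain ⟨s, hs, hc⟩ := hP
  have key : ∀ (M : LeftComodule k C) (q : C ⊗[k] M.carrier →ₗ[k] P.carrier) (m : M.carrier),
      TensorProduct.lift (s ∘ₗ cohomDiff M P q).flip (M.coact m) = 0 := by
    intro M q m
    let Θ : C ⊗[k] (C ⊗[k] M.carrier) →ₗ[k] P.carrier := TensorProduct.lift (s ∘ₗ q).flip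
    have h := LinearMap.congr_fun M.coassoc m
    simp only [LinearMap.comp_apply, LinearEquiv.coe_coe] at h
    trans Θ (M.coact.lTensor C (M.coact m)) - Θ (TensorProduct.assoc k C C M.carrier
      ((Coalgebra.comul (R := k) (A := C)).rTensor M.carrier (M.coact m)))
    · generalize M.coact m = y
      induction y with
      | zero => simp
      | add x y hx hy => simp only [map_add, hx, hy, add_sub_add_comm]
      | tmul c m =>
        simp only [TensorProduct.lift.tmul, LinearMap.flip_apply, LinearMap.comp_apply,
          cohomDiff_apply, map_sub, LinearMap.sub_apply, hc, LinearMap.lTensor_tmul,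
          LinearMap.rTensor_tmul, Θ]
        congr 1
        generalize Coalgebra.comul (R := k) c = y
        induction y with
        | zero => simp
        | add x y hx hy => simp only [map_add, TensorProduct.add_tmul, hx, hy]
        | tmul c m => simp
    · rw [h, sub_self]
  refine Coinjective.of_injective fun L M g hg h ⟨q, hq⟩ =>
    ⟨-TensorProduct.lift (s ∘ₗ h).flip, ?_⟩
  have h0 : TensorProduct.lift (s ∘ₗ h).flip ∘ₗ M.coact = 0 := by
    rw [← LinearMap.cancel_right hg, LinearMap.comp_assoc, g.comm]
    ext l
    rw [LinearMap.zero_comp, LinearMap.zero_apply, ← key L q l, hq, LinearMap.comp_apply,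
      LinearMap.comp_apply]
    generalize L.coact l = y
    induction y with
    | zero => simp
    | add x y hx hy => simp only [map_add, hx, hy]
    | tmul c m => simp
  ext m
  rw [map_neg, LinearMap.neg_apply, cohomDiff_apply, ← LinearMap.comp_apply, h0,
    LinearMap.zero_apply, zero_sub, neg_neg]
  exact (congrArg P.contract (by ext; simp)).trans (hs (h m))

end LeftContramodule

/-! ### Coinjective contramodules are contraflat -/

theorem Coinjective.mem_range {P : LeftContramodule k C} (hP : Coinjective P)
    {L M : LeftComodule k C} (g : L ⟶ M) (hg : Function.Surjective g.toLin)
    (h : M.carrier →ₗ[k] P.carrier) (hh : h ∘ₗ g.toLin ∈ LinearMap.range (cohomDiff L P)) :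
    h ∈ LinearMap.range (cohomDiff M P) := by
  have hs : ShortExactSeq
      (L.incl (LinearMap.ker g.toLin) (fun γ => LeftComodule.act_mem_ker g γ)).toLin g.toLin :=
    { injective := Submodule.subtype_injective _
      exact := LinearMap.exact_subtype_ker_map g.toLin
      surjective := hg }
  rw [← Submodule.Quotient.mk_eq_zero]
  apply (hP _ g hs).injective
  rw [map_zero]
  exact (Submodule.Quotient.mk_eq_zero _).2 hh

/-- In finite dimensions `N ⊙ P = Cohom_C(N^*, P)`, and the transpose of the injection `f` is a
surjection of left comodules. -/
theorem Coinjective.mem_range_of_finite {P : LeftContramodule k C} (hP : Coinjective P)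
    {N N' : RightComodule k C} [Module.Finite k N.carrier] [Module.Finite k N'.carrier]
    (f : N ⟶ N') (hf : Function.Injective f.toLin) (x : N.carrier ⊗[k] P.carrier)
    (hx : f.toLin.rTensor P.carrier x ∈ LinearMap.range (contratensorDiff N' P)) :
    x ∈ LinearMap.range (contratensorDiff N P) := by
  have : Module.Finite k N.dual.carrier := inferInstanceAs (Module.Finite k (Module.Dual k _))
  have : Module.Finite k N'.dual.carrier := inferInstanceAs (Module.Finite k (Module.Dual k _))
  rw [mem_range_contratensorDiff_iff N.dual_coactCompatible]
  rw [mem_range_contratensorDiff_iff N'.dual_coactCompatible] at hx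
  refine hP.mem_range (RightComodule.dualMap f) (LinearMap.dualMap_surjective_of_injective hf) _ ?_
  have h : pairHom (M := N'.dual) (N := N') (Module.evalEquiv k N'.carrier) P.carrier ∘ₗ
      f.toLin.rTensor P.carrier = LinearMap.lcomp k P.carrier (RightComodule.dualMap f).toLin ∘ₗ
        pairHom (M := N.dual) (N := N) (Module.evalEquiv k N.carrier) P.carrier :=
    TensorProduct.ext' fun n p => rfl
  obtain ⟨g, hg⟩ := hx
  exact ⟨g, hg.trans (LinearMap.congr_fun h x)⟩

theorem RightComodule.exists_finite_sub_tensor (N : RightComodule k C) {V : Type u}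
    [AddCommGroup V] [Module k V] (x : N.carrier ⊗[k] V) (W : Submodule k N.carrier)
    [Module.Finite k W] : ∃ S : Submodule k N.carrier, W ≤ S ∧ Module.Finite k S ∧
      (∀ γ, ∀ n ∈ S, N.act γ n ∈ S) ∧ ∃ y : S ⊗[k] V, S.subtype.rTensor V y = x := by
  obtain ⟨U, hU, h⟩ := TensorProduct.exists_finite_submodule_left_of_setFinite {x}
    (Set.finite_singleton x)
  obtain ⟨y, rfl⟩ := h rfl
  obtain ⟨S, hS, hf, ha⟩ := N.exists_finite_sub (W ⊔ U) inferInstance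
  refine ⟨S, le_sup_left.trans hS, hf, ha,
    (Submodule.inclusion (le_sup_right.trans hS)).rTensor V y, ?_⟩
  rw [← LinearMap.comp_apply, ← LinearMap.rTensor_comp, Submodule.subtype_comp_inclusion]

/-- The tensor `x` and the witness `w` that its image vanishes each involve only a
finite-dimensional subcomodule, so the question reduces to the finite-dimensional case. -/
theorem Coinjective.contraflat {P : LeftContramodule k C} (hP : Coinjective P) :
    Contraflat P := by
  refine Contraflat.of_injective fun N N' f hf x ⟨w, hw⟩ => ?_
  obtain ⟨S, -, hSf, hSa, y, rfl⟩ := N.exists_finite_sub_tensor x ⊥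
  -- `S'` must contain `f(S)` as well as the comodule part of `w`, so that `f` restricts to a
  -- morphism of the subcomodules.
  obtain ⟨S', hle, hSf', hSa', w', rfl⟩ := N'.exists_finite_sub_tensor w (S.map f.toLin)
  let i := N.incl S hSa
  let i' := N'.incl S' hSa'
  have hle' : ∀ s : S, f.toLin s ∈ S' := fun s => hle ⟨s, s.2, rfl⟩
  let f' : N.sub S hSa ⟶ N'.sub S' hSa' :=
    RightComodule.homOfAct ((f.toLin ∘ₗ S.subtype).codRestrict S' hle') fun γ s => by
      apply S'.subtype_injective
      refine Eq.trans ?_ (RightComodule.hom_act i' γ _).symm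
      exact (congrArg f.toLin (RightComodule.hom_act i γ s)).trans (RightComodule.hom_act f γ _)
  have hf' : Function.Injective f'.toLin := fun a b h =>
    S.subtype_injective (hf (congrArg Subtype.val h))
  have : Module.Finite k (N.sub S hSa).carrier := hSf
  have : Module.Finite k (N'.sub S' hSa').carrier := hSf'
  obtain ⟨v, hv⟩ := hP.mem_range_of_finite f' hf' y ⟨w', by
    apply rTensor_injective P.carrier S'.subtype_injective
    refine (LinearMap.congr_fun (contratensorDiff_naturality i' P) w').symm.trans (hw.trans ?_)
    rw [← LinearMap.comp_apply, ← LinearMap.rTensor_comp]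
    refine Eq.trans ?_ (LinearMap.rTensor_comp_apply P.carrier S'.subtype f'.toLin y)
    rfl⟩
  refine ⟨i.toLin.rTensor _ v, ?_⟩
  exact (LinearMap.congr_fun (contratensorDiff_naturality i P) v).trans
    (congrArg (i.toLin.rTensor P.carrier) hv)

end Contra

namespace Contra

/-! ### Nakayama's lemma for contramodules -/

section Linear

variable {k : Type u} [Field k] {A V : Type u} [AddCommGroup A] [Module k A]
  [AddCommGroup V] [Module k V]

/-- A locally finite sum of linear maps. -/
theorem exists_locallyFinite_sum (t : ℕ → A →ₗ[k] V) (h : ∀ a, ∃ N, ∀ n ≥ N, t n a = 0) :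
    ∃ g : A →ₗ[k] V, ∀ a, ∃ N, ∀ n ≥ N, g a = ∑ i ∈ Finset.range n, t i a := by
  choose N hN using h
  have hc : ∀ a, ∀ n ≥ N a, ∑ i ∈ Finset.range (N a), t i a = ∑ i ∈ Finset.range n, t i a :=
    fun a n hn => (Finset.eventually_constant_sum (hN a) hn).symm
  refine ⟨{ toFun := fun a => ∑ i ∈ Finset.range (N a), t i a, map_add' := fun a b => ?_,
            map_smul' := fun c a => ?_ }, fun a => ⟨N a, hc a⟩⟩
  · rw [hc (a + b) (max (N (a + b)) (max (N a) (N b))) (by omega),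
      hc a (max (N (a + b)) (max (N a) (N b))) (by omega),
      hc b (max (N (a + b)) (max (N a) (N b))) (by omega), ← Finset.sum_add_distrib]
    simp
  · rw [hc (c • a) (max (N (c • a)) (N a)) (by omega), hc a (max (N (c • a)) (N a)) (by omega),
      RingHom.id_apply, Finset.smul_sum]
    simp

theorem exists_finite_submodule_range_le {E : Type u} [AddCommGroup E] [Module k E]
    [Module.Finite k E] (t : E →ₗ[k] A ⊗[k] V) :
    ∃ D : Submodule k A, Module.Finite k D ∧
      LinearMap.range t ≤ LinearMap.range (D.subtype.rTensor V) := by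
  obtain ⟨s, hs⟩ := (Module.Finite.fg_top : (⊤ : Submodule k E).FG)
  obtain ⟨D, hD, h⟩ := TensorProduct.exists_finite_submodule_left_of_setFinite
    (t '' (s : Set E)) (s.finite_toSet.image t)
  refine ⟨D, hD, ?_⟩
  rw [LinearMap.range_eq_map, ← hs, Submodule.map_span, Submodule.span_le]
  exact h

theorem exists_finset_le_span {ι : Type u} (b : Module.Basis ι k A) (D : Submodule k A)
    [Module.Finite k D] : ∃ J : Finset ι, D ≤ Submodule.span k (b '' J) := by
  classical
  obtain ⟨s, hs⟩ := (Module.Finite.iff_fg.1 ‹_› : D.FG)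
  refine ⟨s.biUnion fun x => (b.repr x).support, ?_⟩
  rw [← hs, Submodule.span_le]
  intro x hx
  refine Submodule.span_mono (Set.image_mono ?_) (b.mem_span_repr_support x)
  exact Finset.coe_subset.2 (Finset.subset_biUnion_of_mem (fun x => (b.repr x).support) hx)

variable {ι : Type u} (b : Module.Basis ι k A)

/-- Adjoining a letter to a word, extended linearly with respect to a basis. -/
noncomputable def consWord : A →ₗ[k] (List ι →₀ k) →ₗ[k] (List ι →₀ k) :=
  b.constr k fun i => Finsupp.lmapDomain k k (List.cons i)

theorem consWord_basis_single (i : ι) (l : List ι) (a : k) :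
    consWord b (b i) (Finsupp.single l a) = Finsupp.single (i :: l) a := by
  simp [consWord, Module.Basis.constr_basis]

end Linear

variable {k C : Type u} [Field k] [AddCommGroup C] [Module k C] [Coalgebra k C]

/-- Every finite-dimensional subspace of `C` is contained in a finite-dimensional left coideal. -/
theorem exists_finite_left_coideal (D : Submodule k C) [Module.Finite k D] :
    ∃ (M : LeftComodule k C) (i : M.carrier →ₗ[k] C), Module.Finite k M.carrier ∧
      Function.Injective i ∧ Coalgebra.comul ∘ₗ i = i.lTensor C ∘ₗ M.coact ∧
      D ≤ LinearMap.range i := by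
  obtain ⟨E, hDE, hE, hEa⟩ := (LeftComodule.regular k C).exists_finite_sub D ‹_›
  refine ⟨(LeftComodule.regular k C).sub E hEa, E.subtype, hE, E.subtype_injective,
    ((LeftComodule.regular k C).incl E hEa).comm, ?_⟩
  intro d hd
  exact ⟨⟨d, hDE hd⟩, rfl⟩

/-! ### Iterated comultiplication recorded by words in a basis -/

section Words

variable {ι : Type u} (b : Module.Basis ι k C)

/-- The iterated comultiplication in coordinates. -/
noncomputable def comulWord : ℕ → C →ₗ[k] (List ι →₀ k)
  | 0 => (Coalgebra.counit (R := k) (A := C)).smulRight (Finsupp.single [] 1)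
  | n + 1 => TensorProduct.lift (consWord b) ∘ₗ (comulWord n).lTensor C ∘ₗ Coalgebra.comul

/-- The point is that `J` does not depend on `n`. A finite-dimensional left coideal `M` containing
`c` has its coaction in `D ⊗ M` with `D` finite-dimensional; iterating never leaves `M`, so every
letter comes from a basis expansion of `D`. -/
theorem exists_comulWord_mem (c : C) : ∃ J : Finset ι, ∀ n,
    comulWord b n c ∈ Finsupp.supported k k {l : List ι | l.length = n ∧ ∀ i ∈ l, i ∈ J} := by
  obtain ⟨M, i, hM, -, hi, hc⟩ := exists_finite_left_coideal (Submodule.span k {c})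
  obtain ⟨D, hD, hDM⟩ := exists_finite_submodule_range_le M.coact
  obtain ⟨J, hJ⟩ := exists_finset_le_span b D
  refine ⟨J, fun n => ?_⟩
  suffices H : ∀ m, comulWord b n (i m) ∈
      Finsupp.supported k k {l : List ι | l.length = n ∧ ∀ i ∈ l, i ∈ J} by
    obtain ⟨m, rfl⟩ := hc (Submodule.mem_span_singleton_self _)
    exact H m
  induction n with
  | zero =>
    intro m
    refine Submodule.smul_mem _ _ (Finsupp.single_mem_supported k 1 ?_)
    simp
  | succ n ih =>
    intro m
    obtain ⟨y, hy⟩ := hDM ⟨m, rfl⟩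
    have h₁ := LinearMap.congr_fun hi m
    simp only [LinearMap.comp_apply, ← hy] at h₁
    rw [comulWord, LinearMap.comp_apply, LinearMap.comp_apply, h₁]
    clear h₁ hy
    induction y with
    | zero => simp
    | add x y hx hy => simp only [map_add]; exact Submodule.add_mem _ hx hy
    | tmul d e =>
      change consWord b d (comulWord b n (i e)) ∈ _
      have hd := hJ d.2
      have he := ih e
      generalize (d : C) = d at hd
      generalize comulWord b n (i e) = w at he
      induction hd using Submodule.span_induction with
      | mem x hx =>
        obtain ⟨i, hi, rfl⟩ := hx
        rw [Finsupp.supported_eq_span_single] at he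
        induction he using Submodule.span_induction with
        | mem x hx =>
          obtain ⟨l, hl, rfl⟩ := hx
          rw [consWord_basis_single]
          refine Finsupp.single_mem_supported k 1 ⟨by simp [hl.1], ?_⟩
          simpa using ⟨hi, hl.2⟩
        | zero => simp
        | add x y _ _ hx hy => rw [map_add]; exact Submodule.add_mem _ hx hy
        | smul a x _ hx => rw [map_smul]; exact Submodule.smul_mem _ a hx
      | zero => simp
      | add x y _ _ hx hy => rw [map_add]; exact Submodule.add_mem _ hx hy
      | smul a x _ hx => rw [map_smul]; exact Submodule.smul_mem _ a hx

end Words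

namespace LeftContramodule

/-- A subcontramodule that is dense for the topology of finite-dimensional subspaces of the
coalgebra is the whole contramodule. -/
theorem mem_of_dense (P : LeftContramodule k C) (S : Submodule k P.carrier)
    (hS : ∀ f : C →ₗ[k] P.carrier, (∀ c, f c ∈ S) → P.contract f ∈ S)
    (H : ∀ D : Submodule k C, Module.Finite k D → ∀ p : P.carrier,
      ∃ f : C →ₗ[k] P.carrier, (∀ c ∈ D, f c = 0) ∧ p - P.contract f ∈ S)
    (q : P.carrier) : q ∈ S := by
  let b := Module.Basis.ofVectorSpace k C
  let ι := Module.Basis.ofVectorSpaceIndex k C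
  -- Density is used with `D` spanned by the letters of a word. The choice `f = 0` when `p = 0`
  -- makes vanishing propagate to longer words.
  have H' : ∀ (l : List ι) (p : P.carrier), ∃ f : C →ₗ[k] P.carrier,
      (∀ i ∈ l, f (b i) = 0) ∧ p - P.contract f ∈ S ∧ (p = 0 → f = 0) := by
    intro l p
    by_cases hp : p = 0
    · exact ⟨0, by simp, by simp [hp], fun _ => rfl⟩
    · obtain ⟨f, hf, h⟩ := H (Submodule.span k (b '' {i | i ∈ l}))
        (Module.Finite.span_of_finite k ((List.finite_toSet l).image b)) p
      exact ⟨f, fun i hi => hf _ (Submodule.subset_span ⟨i, hi, rfl⟩), h, fun h => absurd h hp⟩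
  choose f hf hfS hf0 using H'
  -- Successive approximation starting at `q`: prepending a letter `i` to `l` evaluates at `b i` the
  -- map chosen for `φ l`, which represents `φ l` modulo `S`.
  let φ : List ι → P.carrier := fun l => List.rec q (fun i l p => f l p (b i)) l
  have hφ : ∀ i l, φ (i :: l) = f l (φ l) (b i) := fun i l => rfl
  let Φ : (List ι →₀ k) →ₗ[k] P.carrier := Finsupp.linearCombination k φ
  -- A repeated letter is evaluated by a map chosen to vanish on the letters already used.
  have hφ0 : ∀ l : List ι, ¬ l.Nodup → φ l = 0 := by
    intro l
    induction l with
    | nil => intro h; exact absurd List.nodup_nil h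
    | cons i l ih =>
      intro h
      rw [hφ]
      by_cases hi : i ∈ l
      · exact hf l (φ l) i hi
      · rw [hf0 l _ (ih fun hl => h (List.nodup_cons.2 ⟨hi, hl⟩)), LinearMap.zero_apply]
  have hcons : ∀ c l a, Φ (consWord b c (Finsupp.single l a)) = a • f l (φ l) c := by
    intro c l a
    have : Φ ∘ₗ (consWord b).flip (Finsupp.single l a) = a • f l (φ l) := by
      refine b.ext fun i => ?_
      rw [LinearMap.comp_apply, LinearMap.flip_apply, consWord_basis_single]
      simp [Φ, hφ]
    exact LinearMap.congr_fun this c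
  let t (n : ℕ) : C →ₗ[k] P.carrier := Φ ∘ₗ comulWord b n
  -- `K n v u` puts the letters of `u` in front of the words of length `n` of `v`, so composing with
  -- comultiplication turns `K n` into `t (n + 1)`.
  let K (n : ℕ) : C →ₗ[k] C →ₗ[k] P.carrier := ((consWord b).compr₂ Φ).flip ∘ₗ comulWord b n
  have hvan : ∀ c, ∃ N, ∀ n ≥ N, comulWord b n c ∈ Finsupp.supported k k {l | φ l = 0} := by
    intro c
    obtain ⟨J, hJ⟩ := exists_comulWord_mem b c
    -- Pigeonhole: a word longer than `J.card` with letters in `J` repeats one.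
    refine ⟨J.card + 1, fun n hn => Finsupp.supported_mono ?_ (hJ n)⟩
    rintro l ⟨hl, hlJ⟩
    refine hφ0 l fun hd => ?_
    classical
    have := Finset.card_le_card (s := l.toFinset) (t := J) fun i hi => hlJ i (List.mem_toFinset.1 hi)
    rw [List.toFinset_card_of_nodup hd] at this
    omega
  have hΦ0 : ∀ a ∈ Finsupp.supported k k {l | φ l = 0}, Φ a = 0 := by
    intro a ha
    rw [Finsupp.supported_eq_span_single] at ha
    induction ha using Submodule.span_induction with
    | mem x hx =>
      obtain ⟨l, hl, rfl⟩ := hx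
      have hl : φ l = 0 := hl
      simp [Φ, hl]
    | zero => simp
    | add x y _ _ hx hy => rw [map_add, hx, hy, add_zero]
    | smul c x _ hx => rw [map_smul, hx, smul_zero]
  have hK0 : ∀ a ∈ Finsupp.supported k k {l | φ l = 0},
      ((consWord b).compr₂ Φ).flip a = 0 := by
    intro a ha
    rw [Finsupp.supported_eq_span_single] at ha
    induction ha using Submodule.span_induction with
    | mem x hx =>
      obtain ⟨l, hl, rfl⟩ := hx
      have hl : φ l = 0 := hl
      ext c
      rw [LinearMap.flip_apply, LinearMap.compr₂_apply, hcons, hf0 l _ hl]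
      simp
    | zero => rw [map_zero]
    | add x y _ _ hx hy => rw [map_add, hx, hy, add_zero]
    | smul c x _ hx => rw [map_smul, hx, smul_zero]
  obtain ⟨g, hg⟩ := exists_locallyFinite_sum t fun c => by
    obtain ⟨N, hN⟩ := hvan c
    exact ⟨N, fun n hn => hΦ0 _ (hN n hn)⟩
  obtain ⟨F, hF⟩ := exists_locallyFinite_sum K fun c => by
    obtain ⟨N, hN⟩ := hvan c
    exact ⟨N, fun n hn => hK0 _ (hN n hn)⟩
  have hπ : ∀ a, Φ a - P.contract (((consWord b).compr₂ Φ).flip a) ∈ S := by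
    intro a
    induction a using Finsupp.induction_linear with
    | zero => simp
    | add x y hx hy =>
      rw [map_add, map_add, map_add, add_sub_add_comm]
      exact S.add_mem hx hy
    | single l a =>
      have e : ((consWord b).compr₂ Φ).flip (Finsupp.single l a) = a • f l (φ l) := by
        ext c
        exact hcons c l a
      rw [e, map_smul, Finsupp.linearCombination_single, ← smul_sub]
      exact S.smul_mem a (hfS l (φ l))
  have hgF : ∀ c, (g - P.contract ∘ₗ F) c ∈ S := by
    intro c
    obtain ⟨N₁, h₁⟩ := hg c
    obtain ⟨N₂, h₂⟩ := hF c
    rw [LinearMap.sub_apply, LinearMap.comp_apply, h₁ (max N₁ N₂) (le_max_left _ _),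
      h₂ (max N₁ N₂) (le_max_right _ _), map_sum, ← Finset.sum_sub_distrib]
    exact S.sum_mem fun n _ => hπ (comulWord b n c)
  have hx : ∀ x : C ⊗[k] C, ∃ N, ∀ n ≥ N, TensorProduct.lift F.flip x =
      ∑ i ∈ Finset.range n, Φ (TensorProduct.lift (consWord b) ((comulWord b i).lTensor C x)) := by
    intro x
    induction x with
    | zero => exact ⟨0, by simp⟩
    | add x y hx hy =>
      obtain ⟨N₁, h₁⟩ := hx
      obtain ⟨N₂, h₂⟩ := hy
      refine ⟨max N₁ N₂, fun n hn => ?_⟩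
      rw [map_add, h₁ n (by omega), h₂ n (by omega), ← Finset.sum_add_distrib]
      simp only [map_add]
    | tmul u v =>
      obtain ⟨N, h⟩ := hF v
      refine ⟨N, fun n hn => ?_⟩
      rw [TensorProduct.lift.tmul, LinearMap.flip_apply, h n hn, LinearMap.sum_apply]
      rfl
  -- With `g` the sum of all `t n`, and the comultiplied `F` that of all `t (n + 1)`, only `t 0`,
  -- the map `c ↦ ε(c) q`, survives.
  have hshift : g - TensorProduct.lift F.flip ∘ₗ Coalgebra.comul =
      (Coalgebra.counit (R := k) (A := C)).smulRight q := by
    ext c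
    obtain ⟨N₁, h₁⟩ := hg c
    obtain ⟨N₂, h₂⟩ := hx (Coalgebra.comul (R := k) c)
    rw [LinearMap.sub_apply, LinearMap.comp_apply, h₁ (max N₁ N₂ + 1) (by omega),
      h₂ (max N₁ N₂) (by omega), Finset.sum_range_succ']
    have e : ∀ i, Φ (TensorProduct.lift (consWord b)
        ((comulWord b i).lTensor C (Coalgebra.comul (R := k) c))) = t (i + 1) c := fun i => rfl
    simp only [e, add_sub_cancel_left]
    simp [t, comulWord, Φ, φ]
  -- Contraassociativity replaces `π (π ∘ F)` by the contraction of the shifted sum. The map `g - π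
  -- ∘ F` takes values in `S` by `hgF`.
  have hq : q = P.contract (g - P.contract ∘ₗ F) := by
    rw [map_sub, ← P.contraassoc, ← map_sub, hshift, P.contraunit]
  rw [hq]
  exact hS _ hgF

end LeftContramodule

/-- A morphism of contramodules that becomes surjective after contratensoring with all comodules
is surjective. -/
theorem surjective_of_contratensor {P Q : LeftContramodule k C} (h : P ⟶ Q)
    (H : ∀ (N : RightComodule k C) (x : N.carrier ⊗[k] Q.carrier),
      ∃ y : N.carrier ⊗[k] P.carrier, x - h.toLin.lTensor N.carrier y ∈
        LinearMap.range (contratensorDiff N Q)) :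
    Function.Surjective h.toLin := by
  intro q
  refine Q.mem_of_dense (LinearMap.range h.toLin) (LeftContramodule.contract_mem_range h) ?_ q
  intro D hD q
  obtain ⟨M, i, hM, hi, hic, hDi⟩ := exists_finite_left_coideal D
  let β := LinearEquiv.refl k (Module.Dual k M.carrier)
  let e : C →ₗ[k] Q.carrier := (Coalgebra.counit (R := k) (A := C)).smulRight q
  obtain ⟨x, hx⟩ := (pairHom_bijective (M := M) (N := M.dual) β (V := Q.carrier)).2 (e ∘ₗ i)
  obtain ⟨y, hy⟩ := H M.dual x
  obtain ⟨g, hg⟩ := (mem_range_contratensorDiff_iff M.dual_coactCompatible Q _).1 hy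
  obtain ⟨ρ, hρ⟩ := exists_retraction hi
  let y' : M.carrier →ₗ[k] P.carrier := pairHom (M := M) (N := M.dual) β P.carrier y
  let g' : C ⊗[k] C →ₗ[k] Q.carrier := g ∘ₗ ρ.lTensor C
  let G : C →ₗ[k] C →ₗ[k] Q.carrier := (TensorProduct.curry g').flip
  have hG : TensorProduct.lift G.flip = g' := by
    ext
    rfl
  have hg₁ : cohomDiff M Q g = e ∘ₗ i - h.toLin ∘ₗ y' := by
    rw [hg, ← hx]
    exact (map_sub _ _ _).trans
      (congrArg _ (pairHom_lTensor (M := M) (N := M.dual) β h.toLin y))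
  have hg₂ : (g' ∘ₗ Coalgebra.comul - Q.contract ∘ₗ G) ∘ₗ i = cohomDiff M Q g := by
    ext m
    have h₁ := LinearMap.congr_fun hic m
    simp only [LinearMap.comp_apply] at h₁
    rw [LinearMap.comp_apply, LinearMap.sub_apply, LinearMap.comp_apply, h₁, cohomDiff_apply]
    congr 1
    · rw [LinearMap.comp_apply, ← LinearMap.lTensor_comp_apply,
        show ρ ∘ₗ i = LinearMap.id from LinearMap.ext hρ, LinearMap.lTensor_id, LinearMap.id_apply]
    · refine congrArg Q.contract ?_
      ext c
      exact congrArg (fun z => g (c ⊗ₜ z)) (hρ m)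
  -- The terms are extended from `M` to `C` by the retraction `ρ`. Their combination vanishes on
  -- `M`, hence on `D`, and contracts to `q - h (π (y' ∘ ρ))`, because the last bracket contracts to
  -- zero by contraassociativity.
  refine ⟨e - h.toLin ∘ₗ y' ∘ₗ ρ - (g' ∘ₗ Coalgebra.comul - Q.contract ∘ₗ G), fun c hc => ?_, ?_⟩
  · obtain ⟨m, rfl⟩ := hDi hc
    have h₁ := LinearMap.congr_fun (hg₂.trans hg₁) m
    rw [LinearMap.comp_apply] at h₁
    rw [LinearMap.sub_apply, h₁]
    simp [hρ]
  · refine ⟨P.contract (y' ∘ₗ ρ), ?_⟩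
    rw [map_sub, map_sub, map_sub, ← Q.contraassoc, hG, Q.contraunit, h.comm]
    abel

end Contra

namespace Contra

variable {k C : Type u} [Field k] [AddCommGroup C] [Module k C] [Coalgebra k C]

/-! ### Cofree right comodules and cokernels -/

namespace RightComodule

/-- The cofree right comodule `V ⊗ C`. -/
noncomputable def cofree (V : Type u) [AddCommGroup V] [Module k V] : RightComodule k C where
  carrier := V ⊗[k] C
  coact := (TensorProduct.assoc k V C C).symm.toLinearMap ∘ₗ
    (Coalgebra.comul (R := k) (A := C)).lTensor V
  coassoc := by
    refine TensorProduct.ext' fun v c => ?_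
    have h := Coalgebra.coassoc_apply (R := k) c
    let Ψ : C ⊗[k] (C ⊗[k] C) →ₗ[k] (V ⊗[k] C) ⊗[k] (C ⊗[k] C) :=
      (TensorProduct.mk k V C v).rTensor (C ⊗[k] C)
    simp only [LinearMap.comp_apply, LinearEquiv.coe_coe, LinearMap.lTensor_tmul]
    trans Ψ (TensorProduct.assoc k C C C
      ((Coalgebra.comul (R := k) (A := C)).rTensor C (Coalgebra.comul (R := k) c)))
    · generalize Coalgebra.comul (R := k) c = x
      induction x with
      | zero => simp
      | add x y hx hy => simp only [map_add, TensorProduct.tmul_add, hx, hy]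
      | tmul a b =>
        simp only [LinearMap.rTensor_tmul, TensorProduct.assoc_symm_tmul, LinearMap.comp_apply,
          LinearEquiv.coe_coe, LinearMap.lTensor_tmul]
        generalize Coalgebra.comul (R := k) a = x
        induction x with
        | zero => simp
        | add x y hx hy =>
          simp only [map_add, TensorProduct.add_tmul, TensorProduct.tmul_add, hx, hy]
        | tmul c d => simp [Ψ]
    · rw [h]
      generalize Coalgebra.comul (R := k) c = x
      induction x with
      | zero => simp
      | add x y hx hy => simp only [map_add, TensorProduct.tmul_add, hx, hy]
      | tmul a b =>
        simp only [LinearMap.lTensor_tmul, TensorProduct.assoc_symm_tmul]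
        rfl
  counit_coact := by
    refine TensorProduct.ext' fun v c => ?_
    have h := Coalgebra.lTensor_counit_comul (R := k) c
    simp only [LinearMap.comp_apply, LinearEquiv.coe_coe, LinearMap.lTensor_tmul]
    have h' : ∀ x : C ⊗[k] C, (Coalgebra.counit (R := k) (A := C)).lTensor (V ⊗[k] C)
        ((TensorProduct.assoc k V C C).symm (v ⊗ₜ x)) =
        (TensorProduct.mk k V C v).rTensor k
          ((Coalgebra.counit (R := k) (A := C)).lTensor C x) := by
      intro x
      induction x with
      | zero => simp
      | add x y hx hy => simp only [map_add, TensorProduct.tmul_add, hx, hy]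
      | tmul a b => simp
    rw [h', h]
    simp

/-- The coaction as a morphism to a cofree comodule. -/
noncomputable def coactHom (N : RightComodule k C) : N ⟶ cofree N.carrier :=
  RightComodule.Hom.mk N.coact <| by
    ext n
    have h := LinearMap.congr_fun N.coassoc n
    simp only [LinearMap.comp_apply, LinearEquiv.coe_coe] at h
    exact (LinearEquiv.eq_symm_apply _).2 h |>.symm

theorem coact_injective (N : RightComodule k C) : Function.Injective N.coact := by
  intro x y h
  rw [← N.act_counit x, ← N.act_counit y]
  exact congrArg (sliceRight N.carrier Coalgebra.counit) h

/-- The morphism of cofree comodules induced by a linear map. -/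
noncomputable def cofreeMap {V W : Type u} [AddCommGroup V] [Module k V] [AddCommGroup W]
    [Module k W] (f : V →ₗ[k] W) : (cofree V : RightComodule k C) ⟶ cofree W :=
  RightComodule.Hom.mk (f.rTensor C) <| by
    refine TensorProduct.ext' fun v c => ?_
    change (TensorProduct.assoc k W C C).symm (f v ⊗ₜ Coalgebra.comul (R := k) c) =
      (f.rTensor C).rTensor C ((TensorProduct.assoc k V C C).symm (v ⊗ₜ Coalgebra.comul (R := k) c))
    generalize Coalgebra.comul (R := k) c = x
    induction x with
    | zero => simp
    | add x y hx hy => simp only [map_add, TensorProduct.tmul_add, hx, hy]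
    | tmul a b => simp

/-- The difference of two morphisms of right comodules. -/
def Hom.sub {L N : RightComodule k C} (f g : L ⟶ N) : L ⟶ N :=
  RightComodule.Hom.mk (f.toLin - g.toLin) <| by
    rw [LinearMap.comp_sub, LinearMap.rTensor_sub, LinearMap.sub_comp, f.comm, g.comm]

/-- The second map of the cobar resolution of a right comodule. -/
noncomputable def cobarHom (N : RightComodule k C) :
    (cofree N.carrier : RightComodule k C) ⟶ cofree (N.carrier ⊗[k] C) :=
  Hom.sub (cofreeMap N.coact) (coactHom (cofree N.carrier))

/-- Applying the counit to the last factor is a contracting homotopy: if `(ν ⊗ id) y = (id ⊗ μ) y`,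
then `y` is the coaction of `(id ⊗ ε) y`. -/
theorem cobar_exact (N : RightComodule k C) :
    Function.Exact (coactHom N).toLin (cobarHom N).toLin := by
  intro y
  constructor
  · intro hy
    refine ⟨sliceRight N.carrier Coalgebra.counit y, ?_⟩
    have h₁ : ∀ y, sliceRight (N.carrier ⊗[k] C) Coalgebra.counit (N.coact.rTensor C y) =
        N.coact (sliceRight N.carrier Coalgebra.counit y) := fun y =>
      sliceRight_rTensor _ _ _
    have h₂ := (cofree (k := k) (C := C) N.carrier).act_counit y
    have h₃ : N.coact.rTensor C y = (cofree (k := k) (C := C) N.carrier).coact y := sub_eq_zero.1 hy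
    exact (h₁ y).symm.trans ((congrArg (sliceRight (N.carrier ⊗[k] C) Coalgebra.counit) h₃).trans h₂)
  · rintro ⟨n, rfl⟩
    have h := LinearMap.congr_fun N.coassoc n
    simp only [LinearMap.comp_apply, LinearEquiv.coe_coe] at h
    exact sub_eq_zero.2 ((LinearEquiv.eq_symm_apply _).2 h)

/-- The cokernel of a morphism of right comodules. -/
noncomputable def coker {N N' : RightComodule k C} (f : N ⟶ N') : RightComodule k C :=
  let S := LinearMap.range f.toLin
  let ν : (N'.carrier ⧸ S) →ₗ[k] (N'.carrier ⧸ S) ⊗[k] C :=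
    S.liftQ (S.mkQ.rTensor C ∘ₗ N'.coact) <| by
      rintro _ ⟨n, rfl⟩
      have h := LinearMap.congr_fun f.comm n
      have h₀ : S.mkQ ∘ₗ f.toLin = 0 := LinearMap.range_mkQ_comp f.toLin
      simp only [LinearMap.comp_apply] at h
      rw [LinearMap.mem_ker, LinearMap.comp_apply, h, ← LinearMap.rTensor_comp_apply, h₀]
      simp
  have hν : ν ∘ₗ S.mkQ = S.mkQ.rTensor C ∘ₗ N'.coact := S.liftQ_mkQ _ _
  { carrier := N'.carrier ⧸ S
    coact := ν
    coassoc := by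
      rw [← LinearMap.cancel_right S.mkQ_surjective]
      have h1 : (TensorProduct.assoc k (N'.carrier ⧸ S) C C).toLinearMap ∘ₗ
          (S.mkQ.rTensor C).rTensor C = S.mkQ.rTensor (C ⊗[k] C) ∘ₗ
            (TensorProduct.assoc k N'.carrier C C).toLinearMap := by
        ext; simp
      have h2 : (Coalgebra.comul (R := k) (A := C)).lTensor (N'.carrier ⧸ S) ∘ₗ S.mkQ.rTensor C =
          S.mkQ.rTensor (C ⊗[k] C) ∘ₗ (Coalgebra.comul (R := k) (A := C)).lTensor N'.carrier := by
        ext; simp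
      rw [LinearMap.comp_assoc, LinearMap.comp_assoc, hν, ← LinearMap.comp_assoc _ _ (ν.rTensor C),
        ← LinearMap.rTensor_comp, hν, LinearMap.rTensor_comp, LinearMap.comp_assoc,
        ← LinearMap.comp_assoc, h1, LinearMap.comp_assoc, N'.coassoc, LinearMap.comp_assoc, hν,
        ← LinearMap.comp_assoc, ← LinearMap.comp_assoc, h2]
    counit_coact := by
      rw [← LinearMap.cancel_right S.mkQ_surjective]
      have h2 : (Coalgebra.counit (R := k) (A := C)).lTensor (N'.carrier ⧸ S) ∘ₗ S.mkQ.rTensor C =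
          S.mkQ.rTensor k ∘ₗ (Coalgebra.counit (R := k) (A := C)).lTensor N'.carrier := by
        ext; simp
      rw [LinearMap.comp_assoc, hν, ← LinearMap.comp_assoc, h2, LinearMap.comp_assoc,
        N'.counit_coact]
      ext; simp }

/-- The projection to the cokernel. -/
noncomputable def cokerMk {N N' : RightComodule k C} (f : N ⟶ N') : N' ⟶ coker f :=
  RightComodule.Hom.mk (LinearMap.range f.toLin).mkQ <| by
    ext n
    rfl

end RightComodule

theorem Contraflat.mem_range {P : LeftContramodule k C} (hP : Contraflat P)
    {N N' : RightComodule k C} (f : N ⟶ N') (hf : Function.Injective f.toLin)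
    (x : N.carrier ⊗[k] P.carrier)
    (hx : f.toLin.rTensor P.carrier x ∈ LinearMap.range (contratensorDiff N' P)) :
    x ∈ LinearMap.range (contratensorDiff N P) := by
  have hs : ShortExactSeq f.toLin (RightComodule.cokerMk f).toLin :=
    { injective := hf
      exact := LinearMap.exact_map_mkQ_range f.toLin
      surjective := Submodule.mkQ_surjective _ }
  rw [← Submodule.Quotient.mk_eq_zero]
  apply (hP _ _ hs).injective
  rw [map_zero]
  exact (Submodule.Quotient.mk_eq_zero _).2 hx

/-- Exactness in the middle without surjectivity of `g`: the image of `g` injects into `N₃`, so `y`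
already dies in the contratensor product of that image with `P`, where right exactness applies. -/
theorem Contraflat.exists_preimage {P : LeftContramodule k C} (hP : Contraflat P)
    {N₁ N₂ N₃ : RightComodule k C} (f : N₁ ⟶ N₂) (g : N₂ ⟶ N₃) (he : Function.Exact f.toLin g.toLin)
    (y : N₂.carrier ⊗[k] P.carrier)
    (hy : g.toLin.rTensor P.carrier y ∈ LinearMap.range (contratensorDiff N₃ P)) :
    ∃ x, y - f.toLin.rTensor P.carrier x ∈ LinearMap.range (contratensorDiff N₂ P) := by
  let X := N₃.sub (LinearMap.range g.toLin) fun γ => RightComodule.act_mem_range g γ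
  let i : X ⟶ N₃ := N₃.incl (LinearMap.range g.toLin) fun γ => RightComodule.act_mem_range g γ
  let g' : N₂ ⟶ X := RightComodule.homOfAct g.toLin.rangeRestrict fun γ n =>
    Submodule.subtype_injective _ <|
      (RightComodule.hom_act g γ n).trans (RightComodule.hom_act i γ (g.toLin.rangeRestrict n)).symm
  have hg' : g'.toLin.rTensor P.carrier y ∈ LinearMap.range (contratensorDiff X P) := by
    refine hP.mem_range i (Submodule.subtype_injective _) _ ?_
    obtain ⟨w, hw⟩ := hy
    exact ⟨w, hw.trans (LinearMap.rTensor_comp_apply P.carrier i.toLin g'.toLin y)⟩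
  obtain ⟨w, hw⟩ := hg'
  have hsurj : Function.Surjective g'.toLin := g.toLin.surjective_rangeRestrict
  obtain ⟨w, rfl⟩ := LinearMap.rTensor_surjective _ hsurj w
  have hn := LinearMap.congr_fun (contratensorDiff_naturality g' P) w
  simp only [LinearMap.comp_apply] at hn
  have he' : Function.Exact f.toLin g'.toLin := fun n =>
    Iff.trans ⟨fun h => congrArg Subtype.val h, fun h => Subtype.ext h⟩ (he n)
  obtain ⟨x, hx⟩ := (rTensor_exact P.carrier he' hsurj (y - contratensorDiff N₂ P w)).1 (by
    rw [map_sub, ← hn, hw, sub_self])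
  exact ⟨x, w, by rw [hx]; abel⟩

/-! ### The left comodule `C ⊙ P` -/

/-- The map `(V ⊗ C) ⊗ P → V ⊗ (C ⊙ P)`. -/
noncomputable def cofreeContratensor (P : LeftContramodule k C) (V : Type u) [AddCommGroup V]
    [Module k V] : (V ⊗[k] C) ⊗[k] P.carrier →ₗ[k]
      V ⊗[k] Contratensor (RightComodule.regular k C) P :=
  ((LinearMap.range (contratensorDiff (RightComodule.regular k C) P)).mkQ).lTensor V ∘ₗ
    (TensorProduct.assoc k V C P.carrier).toLinearMap

theorem contratensorDiff_cofree (P : LeftContramodule k C) (V : Type u) [AddCommGroup V]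
    [Module k V] (x : (V ⊗[k] C) ⊗[k] (C →ₗ[k] P.carrier)) :
    TensorProduct.assoc k V C P.carrier (contratensorDiff (RightComodule.cofree V) P x) =
      (contratensorDiff (RightComodule.regular k C) P).lTensor V
        (TensorProduct.assoc k V C (C →ₗ[k] P.carrier) x) := by
  have h : (TensorProduct.assoc k V C P.carrier).toLinearMap ∘ₗ
      contratensorDiff (RightComodule.cofree V) P =
      (contratensorDiff (RightComodule.regular k C) P).lTensor V ∘ₗ
        (TensorProduct.assoc k V C (C →ₗ[k] P.carrier)).toLinearMap := by
    refine TensorProduct.ext_threefold fun v c f => ?_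
    change TensorProduct.assoc k V C P.carrier
      (contratensorDiff (RightComodule.cofree V) P ((v ⊗ₜ[k] c) ⊗ₜ[k] f)) =
      v ⊗ₜ contratensorDiff (RightComodule.regular k C) P (c ⊗ₜ f)
    refine (congrArg _ (contratensorDiff_tmul (RightComodule.cofree V) P (v ⊗ₜ[k] c) f)).trans
      (Eq.trans ?_ (congrArg (TensorProduct.mk k V (C ⊗[k] P.carrier) v)
        (contratensorDiff_tmul (RightComodule.regular k C) P c f)).symm)
    refine (map_sub (TensorProduct.assoc k V C P.carrier) _ _).trans
      (Eq.trans ?_ (map_sub (TensorProduct.mk k V (C ⊗[k] P.carrier) v) _ _).symm)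
    refine congrArg (· - _) ?_
    change TensorProduct.assoc k V C P.carrier (f.lTensor (V ⊗[k] C)
      ((TensorProduct.assoc k V C C).symm (v ⊗ₜ Coalgebra.comul (R := k) c))) =
      v ⊗ₜ f.lTensor C (Coalgebra.comul (R := k) c)
    generalize Coalgebra.comul (R := k) c = x
    induction x with
    | zero => simp
    | add x y hx hy => simp only [map_add, TensorProduct.tmul_add, hx, hy]
    | tmul a b => simp
  exact LinearMap.congr_fun h x

/-- This is `(V ⊗ C) ⊙ P = V ⊗ (C ⊙ P)`, by exactness of `V ⊗ -`. -/
theorem cofreeContratensor_eq_zero_iff (P : LeftContramodule k C) (V : Type u) [AddCommGroup V]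
    [Module k V] (x : (V ⊗[k] C) ⊗[k] P.carrier) :
    cofreeContratensor P V x = 0 ↔
      x ∈ LinearMap.range (contratensorDiff (RightComodule.cofree V) P) := by
  have he := lTensor_exact V
    (LinearMap.exact_map_mkQ_range (contratensorDiff (RightComodule.regular k C) P))
    (Submodule.mkQ_surjective _)
  constructor
  · intro h
    obtain ⟨y, hy⟩ := (he _).1 h
    obtain ⟨w, rfl⟩ := (TensorProduct.assoc k V C (C →ₗ[k] P.carrier)).surjective y
    exact ⟨w, (TensorProduct.assoc k V C P.carrier).injective
      ((contratensorDiff_cofree P V w).trans hy)⟩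
  · rintro ⟨w, rfl⟩
    exact (he _).2 ⟨_, (contratensorDiff_cofree P V w).symm⟩

theorem cofreeContratensor_surjective (P : LeftContramodule k C) (V : Type u) [AddCommGroup V]
    [Module k V] : Function.Surjective (cofreeContratensor P V) :=
  (LinearMap.lTensor_surjective V (Submodule.mkQ_surjective _)).comp
    (TensorProduct.assoc k V C P.carrier).surjective

/-- The natural map `N ⊗ P → N ⊗ (C ⊙ P)`. -/
noncomputable def contratensorCoaction (N : RightComodule k C) (P : LeftContramodule k C) :
    N.carrier ⊗[k] P.carrier →ₗ[k]
      N.carrier ⊗[k] Contratensor (RightComodule.regular k C) P :=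
  cofreeContratensor P N.carrier ∘ₗ N.coact.rTensor P.carrier

/-- The map `c ↦ c ⊙ p`. -/
noncomputable def tensorElement (P : LeftContramodule k C) (p : P.carrier) :
    C →ₗ[k] Contratensor (RightComodule.regular k C) P :=
  (LinearMap.range (contratensorDiff (RightComodule.regular k C) P)).mkQ ∘ₗ
    (TensorProduct.mk k C P.carrier).flip p

theorem cofreeContratensor_tmul (P : LeftContramodule k C) {V : Type u} [AddCommGroup V]
    [Module k V] (x : V ⊗[k] C) (p : P.carrier) :
    cofreeContratensor P V (x ⊗ₜ p) = (tensorElement P p).lTensor V x := by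
  induction x with
  | zero => simp
  | add x y hx hy => simp only [map_add, TensorProduct.add_tmul, hx, hy]
  | tmul v c => rfl

theorem contratensorCoaction_tmul (N : RightComodule k C) (P : LeftContramodule k C)
    (n : N.carrier) (p : P.carrier) :
    contratensorCoaction N P (n ⊗ₜ p) = (tensorElement P p).lTensor N.carrier (N.coact n) := by
  rw [contratensorCoaction, LinearMap.comp_apply, LinearMap.rTensor_tmul, cofreeContratensor_tmul]

theorem contratensorCoaction_eq_zero (N : RightComodule k C) (P : LeftContramodule k C)
    (w : N.carrier ⊗[k] (C →ₗ[k] P.carrier)) :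
    contratensorCoaction N P (contratensorDiff N P w) = 0 := by
  refine (cofreeContratensor_eq_zero_iff P N.carrier _).2 ⟨N.coact.rTensor _ w, ?_⟩
  exact LinearMap.congr_fun (contratensorDiff_naturality N.coactHom P) w

/-- The coaction embeds `N` in a cofree comodule, and contraflatness keeps `N ⊙ P → N ⊗ (C ⊙ P)`
injective. -/
theorem Contraflat.mem_range_of_contratensorCoaction {P : LeftContramodule k C}
    (hP : Contraflat P) (N : RightComodule k C) (x : N.carrier ⊗[k] P.carrier)
    (hx : contratensorCoaction N P x = 0) : x ∈ LinearMap.range (contratensorDiff N P) :=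
  hP.mem_range N.coactHom N.coact_injective x ((cofreeContratensor_eq_zero_iff P N.carrier _).1 hx)

/-- The coaction on `C ⊙ P`. -/
noncomputable def regularContratensorCoact (P : LeftContramodule k C) :
    Contratensor (RightComodule.regular k C) P →ₗ[k]
      C ⊗[k] Contratensor (RightComodule.regular k C) P :=
  Submodule.liftQ _ (contratensorCoaction (RightComodule.regular k C) P) <| by
    rintro _ ⟨w, rfl⟩
    exact contratensorCoaction_eq_zero _ P w

theorem regularContratensorCoact_tensorElement (P : LeftContramodule k C) (p : P.carrier) :
    regularContratensorCoact P ∘ₗ tensorElement P p =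
      (tensorElement P p).lTensor C ∘ₗ Coalgebra.comul := by
  ext c
  exact contratensorCoaction_tmul (RightComodule.regular k C) P c p

theorem regularContratensor_ext {P : LeftContramodule k C} {V : Type u} [AddCommGroup V]
    [Module k V] {f g : Contratensor (RightComodule.regular k C) P →ₗ[k] V}
    (h : ∀ p, f ∘ₗ tensorElement P p = g ∘ₗ tensorElement P p) : f = g := by
  apply Submodule.linearMap_qext
  exact TensorProduct.ext' fun c p => LinearMap.congr_fun (h p) c

/-- The left comodule `C ⊙ P`. -/
noncomputable def regularContratensor (P : LeftContramodule k C) : LeftComodule k C where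
  carrier := Contratensor (RightComodule.regular k C) P
  coact := regularContratensorCoact P
  coassoc := by
    refine regularContratensor_ext fun p => ?_
    ext c
    have h := LinearMap.congr_fun (regularContratensorCoact_tensorElement P p) c
    have h' := Coalgebra.coassoc_apply (R := k) c
    simp only [LinearMap.comp_apply, LinearEquiv.coe_coe] at h ⊢
    rw [h, ← LinearMap.lTensor_comp_apply, regularContratensorCoact_tensorElement,
      LinearMap.lTensor_comp_apply, ← h']
    generalize Coalgebra.comul (R := k) c = x
    induction x with
    | zero => simp
    | add x y hx hy => simp only [map_add, hx, hy]
    | tmul a b =>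
      simp only [LinearMap.lTensor_tmul, LinearMap.rTensor_tmul]
      generalize Coalgebra.comul (R := k) a = x
      induction x with
      | zero => simp
      | add x y hx hy => simp only [map_add, TensorProduct.add_tmul, hx, hy]
      | tmul a b => simp
  counit_coact := by
    refine regularContratensor_ext fun p => ?_
    ext c
    have h := LinearMap.congr_fun (regularContratensorCoact_tensorElement P p) c
    have h' := Coalgebra.rTensor_counit_comul (R := k) c
    simp only [LinearMap.comp_apply] at h ⊢
    rw [h, ← LinearMap.comp_apply, LinearMap.rTensor_comp_lTensor,
      ← LinearMap.lTensor_comp_rTensor, LinearMap.comp_apply, h']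
    simp

theorem lTensor_coact_mem_cotensor (N : RightComodule k C) (M : LeftComodule k C)
    (φ : C →ₗ[k] M.carrier) (hφ : M.coact ∘ₗ φ = φ.lTensor C ∘ₗ Coalgebra.comul)
    (n : N.carrier) : φ.lTensor N.carrier (N.coact n) ∈ cotensor N M := by
  rw [cotensor, LinearMap.mem_ker, cotensorDiff, LinearMap.sub_apply, sub_eq_zero,
    ← LinearMap.lTensor_comp_apply, hφ, LinearMap.lTensor_comp_apply]
  have h := LinearMap.congr_fun N.coassoc n
  simp only [LinearMap.comp_apply, LinearEquiv.coe_coe] at h ⊢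
  rw [← h]
  generalize N.coact n = x
  induction x with
  | zero => simp
  | add x y hx hy => simp only [map_add, hx, hy]
  | tmul n c =>
    simp only [LinearMap.lTensor_tmul, LinearMap.rTensor_tmul]
    generalize N.coact n = x
    induction x with
    | zero => simp
    | add x y hx hy => simp only [map_add, TensorProduct.add_tmul, hx, hy]
    | tmul a b => simp

theorem contratensorCoaction_mem_cotensor (N : RightComodule k C) (P : LeftContramodule k C)
    (x : N.carrier ⊗[k] P.carrier) :
    contratensorCoaction N P x ∈ cotensor N (regularContratensor P) := by
  induction x with
  | zero => rw [map_zero]; exact Submodule.zero_mem _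
  | add x y hx hy => rw [map_add]; exact Submodule.add_mem _ hx hy
  | tmul n p =>
    rw [contratensorCoaction_tmul]
    exact lTensor_coact_mem_cotensor N (regularContratensor P) (tensorElement P p)
      (regularContratensorCoact_tensorElement P p) n

/-- Contratensoring the cobar map with `P` gives the difference map that defines `N □ (C ⊙ P)`. -/
theorem assoc_cofreeContratensor_cobarHom (N : RightComodule k C) (P : LeftContramodule k C)
    (y : (N.carrier ⊗[k] C) ⊗[k] P.carrier) :
    TensorProduct.assoc k N.carrier C _ (cofreeContratensor P (N.carrier ⊗[k] C)
      ((RightComodule.cobarHom N).toLin.rTensor P.carrier y)) =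
      cotensorDiff N (regularContratensor P) (cofreeContratensor P N.carrier y) := by
  have h : (TensorProduct.assoc k N.carrier C _).toLinearMap ∘ₗ
      cofreeContratensor P (N.carrier ⊗[k] C) ∘ₗ
        (RightComodule.cobarHom N).toLin.rTensor P.carrier =
      cotensorDiff N (regularContratensor P) ∘ₗ cofreeContratensor P N.carrier := by
    refine TensorProduct.ext_threefold fun n c p => ?_
    change TensorProduct.assoc k N.carrier C _ (cofreeContratensor P (N.carrier ⊗[k] C)
      ((N.coact n ⊗ₜ c - (TensorProduct.assoc k N.carrier C C).symm
        (n ⊗ₜ Coalgebra.comul (R := k) c)) ⊗ₜ p)) =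
      cotensorDiff N (regularContratensor P) (cofreeContratensor P N.carrier ((n ⊗ₜ c) ⊗ₜ p))
    rw [cofreeContratensor_tmul, cofreeContratensor_tmul, LinearMap.lTensor_tmul, map_sub, map_sub]
    refine Eq.trans ?_
      (cotensorDiff_tmul N (regularContratensor P) n (tensorElement P p c)).symm
    congr 1
    have h₁ := LinearMap.congr_fun (regularContratensorCoact_tensorElement P p) c
    refine Eq.trans ?_ (congrArg (fun z => n ⊗ₜ[k] z) h₁.symm)
    rw [LinearMap.comp_apply]
    generalize Coalgebra.comul (R := k) c = x
    induction x with
    | zero => simp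
    | add x y hx hy => simp only [map_add, TensorProduct.tmul_add, hx, hy]
    | tmul a b => simp
  exact LinearMap.congr_fun h y

/-- Contraflatness keeps the cobar sequence exact, so `N ⊙ P` maps onto the kernel `N □ (C ⊙ P)`. -/
theorem Contraflat.exists_contratensorCoaction_eq {P : LeftContramodule k C}
    (hP : Contraflat P) (N : RightComodule k C)
    (z : N.carrier ⊗[k] Contratensor (RightComodule.regular k C) P)
    (hz : z ∈ cotensor N (regularContratensor P)) :
    ∃ x : N.carrier ⊗[k] P.carrier, contratensorCoaction N P x = z := by
  obtain ⟨y, rfl⟩ := cofreeContratensor_surjective P N.carrier z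
  have hz' : cotensorDiff N (regularContratensor P) (cofreeContratensor P N.carrier y) = 0 := hz
  obtain ⟨x, hx⟩ := hP.exists_preimage N.coactHom N.cobarHom N.cobar_exact y
    ((cofreeContratensor_eq_zero_iff P _ _).1
      ((TensorProduct.assoc k N.carrier C _).injective
        ((assoc_cofreeContratensor_cobarHom N P y).trans
          (hz'.trans (map_zero _).symm))))
  refine ⟨x, ?_⟩
  have h := (cofreeContratensor_eq_zero_iff P N.carrier _).2 hx
  exact (sub_eq_zero.1 ((map_sub (cofreeContratensor P N.carrier) _ _).symm.trans h)).symm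

theorem contratensorCoaction_naturality {N N' : RightComodule k C} (g : N ⟶ N')
    (P : LeftContramodule k C) (x : N.carrier ⊗[k] P.carrier) :
    contratensorCoaction N' P (g.toLin.rTensor P.carrier x) =
      g.toLin.rTensor _ (contratensorCoaction N P x) := by
  induction x with
  | zero => simp
  | add x y hx hy => simp only [map_add, hx, hy]
  | tmul n p =>
    have h := LinearMap.congr_fun g.comm n
    simp only [LinearMap.comp_apply] at h
    rw [LinearMap.rTensor_tmul, contratensorCoaction_tmul, contratensorCoaction_tmul, h]
    generalize N.coact n = y
    induction y with
    | zero => simp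
    | add x y hx hy => simp only [map_add, hx, hy]
    | tmul n c => simp

/-- Since `N □ (C ⊙ P)` is the image of `N ⊗ P`, it inherits preservation of surjections in `N`. -/
theorem Contraflat.coflat_regularContratensor {P : LeftContramodule k C} (hP : Contraflat P) :
    Coflat (regularContratensor P) := by
  refine Coflat.of_surjective fun N N' g hg z hz => ?_
  obtain ⟨x, rfl⟩ := hP.exists_contratensorCoaction_eq N' z hz
  obtain ⟨x, rfl⟩ := LinearMap.rTensor_surjective P.carrier hg x
  exact ⟨contratensorCoaction N P x, contratensorCoaction_mem_cotensor N P x,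
    (contratensorCoaction_naturality g P x).symm⟩

end Contra

namespace Contra

variable {k C : Type u} [Field k] [AddCommGroup C] [Module k C] [Coalgebra k C]

/-! ### The contramodule of comodule homomorphisms from the coalgebra -/

/-- A subcontramodule. -/
noncomputable def LeftContramodule.sub (P : LeftContramodule k C) (S : Submodule k P.carrier)
    (hS : ∀ f : C →ₗ[k] P.carrier, (∀ c, f c ∈ S) → P.contract f ∈ S) :
    LeftContramodule k C where
  carrier := S
  contract := (P.contract ∘ₗ S.subtype.compRight k).codRestrict S fun f => hS _ fun c => (f c).2
  contraassoc F := by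
    apply S.subtype_injective
    refine Eq.trans (congrArg P.contract ?_) (P.contraassoc (S.subtype.compRight k ∘ₗ F))
    change S.subtype ∘ₗ _ = _
    rw [← LinearMap.comp_assoc]
    congr 1
    ext
    simp
  contraunit p := by
    apply S.subtype_injective
    exact Eq.trans (congrArg P.contract (by ext; rfl)) (P.contraunit (p : P.carrier))

namespace LeftComodule

/-- The comodule homomorphisms `C → M`. -/
def homSubmodule (M : LeftComodule k C) : Submodule k (C →ₗ[k] M.carrier) where
  carrier := {φ | M.coact ∘ₗ φ = φ.lTensor C ∘ₗ Coalgebra.comul}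
  zero_mem' := by simp
  add_mem' {φ ψ} hφ hψ := by
    change M.coact ∘ₗ φ = _ at hφ
    change M.coact ∘ₗ ψ = _ at hψ
    change M.coact ∘ₗ (φ + ψ) = _
    rw [LinearMap.comp_add, hφ, hψ, LinearMap.lTensor_add, LinearMap.add_comp]
  smul_mem' a φ hφ := by
    change M.coact ∘ₗ φ = _ at hφ
    change M.coact ∘ₗ (a • φ) = _
    rw [LinearMap.comp_smul, hφ, LinearMap.lTensor_smul, LinearMap.smul_comp]

theorem lift_comp_comul_mem_homSubmodule (M : LeftComodule k C) (F : C →ₗ[k] C →ₗ[k] M.carrier)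
    (hF : ∀ c, F c ∈ M.homSubmodule) :
    TensorProduct.lift F.flip ∘ₗ Coalgebra.comul ∈ M.homSubmodule := by
  change M.coact ∘ₗ _ = _
  ext c
  have h := Coalgebra.coassoc_apply (R := k) c
  simp only [LinearMap.comp_apply, LinearMap.lTensor_comp_apply]
  rw [← h]
  generalize Coalgebra.comul (R := k) c = x
  induction x with
  | zero => simp
  | add x y hx hy => simp only [map_add, hx, hy]
  | tmul a b =>
    have h' := LinearMap.congr_fun (show M.coact ∘ₗ F b = _ from hF b) a
    simp only [LinearMap.comp_apply] at h'
    rw [TensorProduct.lift.tmul, LinearMap.flip_apply, h', LinearMap.rTensor_tmul]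
    generalize Coalgebra.comul (R := k) a = x
    induction x with
    | zero => simp
    | add x y hx hy => simp only [map_add, TensorProduct.add_tmul, hx, hy]
    | tmul a b => simp

/-- The contramodule of comodule homomorphisms `C → M`. -/
noncomputable def homContra (M : LeftComodule k C) : LeftContramodule k C :=
  ((RightComodule.regular k C).homContra M.carrier).sub M.homSubmodule
    M.lift_comp_comul_mem_homSubmodule

/-- A splitting of the coaction of `M` gives comodule homomorphisms `C → M`. -/
noncomputable def splitHom (M : LeftComodule k C) (r : C ⊗[k] M.carrier →ₗ[k] M.carrier)
    (hr : ∀ c m, M.coact (r (c ⊗ₜ m)) =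
      r.lTensor C (TensorProduct.assoc k C C M.carrier (Coalgebra.comul c ⊗ₜ m))) :
    M.carrier →ₗ[k] M.homSubmodule :=
  (TensorProduct.curry r).flip.codRestrict M.homSubmodule fun m => by
    change M.coact ∘ₗ _ = _
    ext c
    refine (hr c m).trans ?_
    rw [LinearMap.comp_apply]
    generalize Coalgebra.comul (R := k) c = x
    induction x with
    | zero => simp
    | add x y hx hy => simp only [map_add, TensorProduct.add_tmul, hx, hy]
    | tmul a b => simp

theorem splitHom_comp (M : LeftComodule k C) (r : C ⊗[k] M.carrier →ₗ[k] M.carrier)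
    (hr₁ : ∀ m, r (M.coact m) = m)
    (hr : ∀ c m, M.coact (r (c ⊗ₜ m)) =
      r.lTensor C (TensorProduct.assoc k C C M.carrier (Coalgebra.comul c ⊗ₜ m)))
    (φ : M.homSubmodule) :
    TensorProduct.lift (M.homSubmodule.subtype ∘ₗ M.splitHom r hr ∘ₗ φ.1).flip ∘ₗ
      Coalgebra.comul = φ.1 := by
  ext c
  have h := LinearMap.congr_fun (show M.coact ∘ₗ φ.1 = _ from φ.2) c
  rw [← hr₁ (φ.1 c)]
  simp only [LinearMap.comp_apply] at h ⊢
  rw [h]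
  generalize Coalgebra.comul (R := k) c = x
  induction x with
  | zero => simp
  | add x y hx hy => simp only [map_add, hx, hy]
  | tmul a b => simp [splitHom]

/-- `Hom_C(C, -)` takes the cofree comodule `C ⊗ M` to the free contramodule `Hom(C, M)`, and
summands to summands. Explicitly, the section composes `φ` with `m ↦ r (- ⊗ m)`. -/
theorem IsSplit.isSplit_homContra {M : LeftComodule k C} (hM : M.IsSplit) :
    M.homContra.IsSplit := by
  obtain ⟨r, hr₁, hr⟩ := hM
  let s : M.homSubmodule →ₗ[k] C →ₗ[k] M.homSubmodule :=
    (M.splitHom r hr).compRight k ∘ₗ M.homSubmodule.subtype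
  refine ⟨s, fun φ => M.homSubmodule.subtype_injective (M.splitHom_comp r hr₁ hr φ), fun F => ?_⟩
  let F' : C →ₗ[k] M.homSubmodule := F
  change M.splitHom r hr ∘ₗ TensorProduct.lift (M.homSubmodule.subtype ∘ₗ F').flip ∘ₗ
    Coalgebra.comul = TensorProduct.lift (s ∘ₗ F').flip ∘ₗ Coalgebra.comul
  rw [← LinearMap.comp_assoc]
  congr 1
  ext
  rfl

end LeftComodule

/-- The natural map `N ⊗ Hom_C(C, M) → N ⊗ M`. -/
noncomputable def homContraEval (N : RightComodule k C) (M : LeftComodule k C) :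
    N.carrier ⊗[k] M.homSubmodule →ₗ[k] N.carrier ⊗[k] M.carrier :=
  TensorProduct.lift <| LinearMap.mk₂ k (fun n (φ : M.homSubmodule) =>
    φ.1.lTensor N.carrier (N.coact n)) (by intros; simp) (by intros; simp)
    (by intros; simp [LinearMap.lTensor_add]) (by intros; simp [LinearMap.lTensor_smul])

theorem homContraEval_tmul (N : RightComodule k C) (M : LeftComodule k C) (n : N.carrier)
    (φ : M.homSubmodule) :
    homContraEval N M (n ⊗ₜ φ) = φ.1.lTensor N.carrier (N.coact n) := rfl

theorem homContraEval_mem_cotensor (N : RightComodule k C) (M : LeftComodule k C)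
    (y : N.carrier ⊗[k] M.homSubmodule) : homContraEval N M y ∈ cotensor N M := by
  induction y with
  | zero => rw [map_zero]; exact Submodule.zero_mem _
  | add x y hx hy => rw [map_add]; exact Submodule.add_mem _ hx hy
  | tmul n φ => exact lTensor_coact_mem_cotensor N M φ.1 φ.2 n

/-- The splitting gives a homotopy `D ∘ s + id = ρ ∘ eval` on `N ⊗ Hom_C(C, M)`, so an element
killed by evaluation is a boundary. -/
theorem LeftComodule.IsSplit.mem_range_of_homContraEval {M : LeftComodule k C} (hM : M.IsSplit)
    (N : RightComodule k C) (y : N.carrier ⊗[k] M.homSubmodule) (hy : homContraEval N M y = 0) :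
    y ∈ LinearMap.range (contratensorDiff N M.homContra) := by
  obtain ⟨r, hr₁, hr⟩ := hM
  let ρ := M.splitHom r hr
  let s : M.homSubmodule →ₗ[k] C →ₗ[k] M.homSubmodule := ρ.compRight k ∘ₗ M.homSubmodule.subtype
  let D : N.carrier ⊗[k] (C →ₗ[k] M.homSubmodule) →ₗ[k] N.carrier ⊗[k] M.homSubmodule :=
    contratensorDiff N M.homContra
  have h : D ∘ₗ s.lTensor N.carrier + LinearMap.id = ρ.lTensor N.carrier ∘ₗ homContraEval N M := by
    refine TensorProduct.ext' fun n φ => ?_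
    have h₁ : D (n ⊗ₜ s φ) = (s φ).lTensor N.carrier (N.coact n) - n ⊗ₜ φ := by
      refine (contratensorDiff_tmul N M.homContra n (s φ)).trans ?_
      refine congrArg (fun z : M.homSubmodule => (s φ).lTensor N.carrier (N.coact n) - n ⊗ₜ z) ?_
      exact M.homSubmodule.subtype_injective (M.splitHom_comp r hr₁ hr φ)
    rw [LinearMap.add_apply, LinearMap.comp_apply, LinearMap.lTensor_tmul, h₁, LinearMap.id_apply,
      sub_add_cancel]
    exact (LinearMap.lTensor_comp_apply N.carrier ρ φ.1 (N.coact n)).trans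
      (congrArg _ (homContraEval_tmul N M n φ).symm)
  have h' := LinearMap.congr_fun h y
  rw [LinearMap.comp_apply, hy, map_zero, LinearMap.add_apply, LinearMap.comp_apply,
    LinearMap.id_apply] at h'
  refine ⟨-s.lTensor N.carrier y, (map_neg D _).trans ?_⟩
  exact neg_eq_of_add_eq_zero_right h'

/-! ### Contraflat contramodules are projective -/

/-- The unit `P → Hom_C(C, C ⊙ P)`. -/
noncomputable def homContraUnit (P : LeftContramodule k C) :
    P ⟶ (regularContratensor P).homContra :=
  LeftContramodule.Hom.mk
    (LinearMap.codRestrict (regularContratensor P).homSubmodule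
      ((LinearMap.range (contratensorDiff (RightComodule.regular k C) P)).mkQ.compRight k ∘ₗ
        (TensorProduct.mk k C P.carrier).flip)
      fun p => regularContratensorCoact_tensorElement P p) fun f => by
    apply (regularContratensor P).homSubmodule.subtype_injective
    refine LinearMap.ext fun c => ?_
    let q : C ⊗[k] P.carrier →ₗ[k] Contratensor (RightComodule.regular k C) P :=
      (LinearMap.range (contratensorDiff (RightComodule.regular k C) P)).mkQ
    have h₁ : q (f.lTensor C (Coalgebra.comul (R := k) c)) = q (c ⊗ₜ P.contract f) := by
      rw [← sub_eq_zero, ← map_sub]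
      exact (Submodule.Quotient.mk_eq_zero _).2
        ⟨c ⊗ₜ f, contratensorDiff_tmul (RightComodule.regular k C) P c f⟩
    have h₂ : q ∘ₗ f.lTensor C = TensorProduct.lift
        ((q.compRight k ∘ₗ (TensorProduct.mk k C P.carrier).flip) ∘ₗ f).flip :=
      TensorProduct.ext' fun a b => rfl
    exact h₁.symm.trans (LinearMap.congr_fun h₂ _)

theorem homContraEval_unit (N : RightComodule k C) (P : LeftContramodule k C)
    (x : N.carrier ⊗[k] P.carrier) :
    homContraEval N (regularContratensor P) ((homContraUnit P).toLin.lTensor N.carrier x) =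
      contratensorCoaction N P x := by
  have h : homContraEval N (regularContratensor P) ∘ₗ (homContraUnit P).toLin.lTensor N.carrier =
      contratensorCoaction N P :=
    TensorProduct.ext' fun n p => (contratensorCoaction_tmul N P n p).symm
  exact LinearMap.congr_fun h x

/-- Both `N ⊙ P` and `N ⊙ Hom_C(C, C ⊙ P)` embed in `N ⊗ (C ⊙ P)`, and by contraflatness the first
already fills `N □ (C ⊙ P)`. So the unit `u` is surjective by the Nakayama lemma, and it splits
since its target is projective. -/
theorem Contraflat.projective {P : LeftContramodule k C} (hP : Contraflat P) : Projective P := by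
  have := hP.coflat_regularContratensor.injective
  have hJ := LeftComodule.isSplit_of_injective (regularContratensor P)
  have hF := hJ.isSplit_homContra.projective
  let u := homContraUnit P
  have hu : Function.Surjective u.toLin := surjective_of_contratensor u
    fun N y => by
      obtain ⟨x, hx⟩ := hP.exists_contratensorCoaction_eq N _ (homContraEval_mem_cotensor N _ y)
      refine ⟨x, hJ.mem_range_of_homContraEval N _ ?_⟩
      refine (map_sub (homContraEval N (regularContratensor P)) y _).trans ?_
      exact sub_eq_zero.2 (hx.symm.trans (homContraEval_unit N P x).symm)
  have : Epi u := LeftContramodule.epi_of_surjective u hu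
  let w : (regularContratensor P).homContra ⟶ P := Projective.factorThru (𝟙 _) u
  have hw : w ≫ u = 𝟙 _ := Projective.factorThru_comp _ _
  have hw' : u.toLin ∘ₗ w.toLin = LinearMap.id := congrArg LeftContramodule.Hom.toLin hw
  -- The section `w` is surjective by the same lemma: `x - w (u x)` is killed by `u` after tensoring
  -- with `N`, hence zero in `N ⊙ P`. This replaces a direct proof that `u` is injective.
  have hws : Function.Surjective w.toLin := surjective_of_contratensor w
    fun N x => by
      refine ⟨u.toLin.lTensor N.carrier x, hP.mem_range_of_contratensorCoaction N _ ?_⟩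
      have h : u.toLin.lTensor N.carrier (w.toLin.lTensor N.carrier (u.toLin.lTensor N.carrier x)) =
          u.toLin.lTensor N.carrier x := by
        rw [← LinearMap.lTensor_comp_apply, hw', LinearMap.lTensor_id, LinearMap.id_apply]
      rw [← homContraEval_unit, map_sub, h, sub_self]
      exact map_zero (homContraEval N (regularContratensor P))
  have hu' : u ≫ w = 𝟙 P := by
    apply LeftContramodule.Hom.ext
    rw [← LinearMap.cancel_right hws]
    refine LinearMap.ext fun y => ?_
    exact congrArg w.toLin (LinearMap.congr_fun hw' y)
  exact Projective.of_iso ⟨w, u, hw, hu'⟩ hF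

end Contra

/-! ### Closing the two cycles of implications -/

theorem mainTheorem3 (k C : Type u) [Field k] [AddCommGroup C] [Module k C] [Coalgebra k C] :
    (∀ M : Contra.LeftComodule k C,
      (Contra.Coflat M ↔ Contra.Coprojective M) ∧
      (Contra.Coprojective M ↔ CategoryTheory.Injective M)) ∧
    (∀ P : Contra.LeftContramodule k C,
      (Contra.Contraflat P ↔ Contra.Coinjective P) ∧
      (Contra.Coinjective P ↔ CategoryTheory.Projective P)) := by
  refine ⟨fun M => ?_, fun P => ?_⟩
  · have h : CategoryTheory.Injective M → Contra.Coprojective M := fun _ =>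
      M.isSplit_of_injective.coprojective
    exact ⟨⟨fun hM => h hM.injective, fun hM => hM.coflat⟩, fun hM => hM.coflat.injective, h⟩
  · have h : CategoryTheory.Projective P → Contra.Coinjective P := fun _ =>
      P.isSplit_of_projective.coinjective
    exact ⟨⟨fun hP => h hP.projective, fun hP => hP.contraflat⟩,
      fun hP => hP.contraflat.projective, h⟩
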